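/- Let $\epsilon_1,\gamma_1:[0,1]\to\mathbb{R}$ be twice continuously differentiable with $\epsilon_1>0$ and $\gamma_1\ge 0$ on $[0,1]$, and for $k\in\mathbb{C}$ let $y(r)=y(r;k)$ be the solution on $[0,1]$ of $$y''+\bigl(k^2\epsilon_1(r)+ik\gamma_1(r)\bigr)y=0,\qquad y(0)=0,\quad y'(0)=1,$$ where $'$ denotes $d/dr$. Put $$B=\int_0^1\sqrt{\epsilon_1(\rho)}\,d\rho,\qquad D=\frac12\int_0^1\frac{\gamma_1(\rho)}{\sqrt{\epsilon_1(\rho)}}\,d\rho .$$ Then $k\mapsto y(1;k)$ and $k\mapsto y'(1;k)$ are entire functions, and: (i) all zeros of $y(1;k)$, repeated according to multiplicity, can be listed as $(z_j)_{j\in\mathbb{Z}\setminus\{0\}}$ so that $$z_j=\frac{j\pi}{B}-\frac{iD}{B}+O\Bigl(\frac1{|j|}\Bigr),\qquad j\in\mathbb{Z}\setminus\{0\};$$ (ii) all zeros of $y'(1;k)$, repeated according to multiplicity, can be listed as $(z'_j)_{j\in\mathbb{Z}}$ so that $$z'_j=\frac{(j-\frac12)\pi}{B}-\frac{iD}{B}+O\Bigl(\frac1{|j|}\Bigr),\qquad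 j\in\mathbb{Z}\setminus\{0\}.$$ The constants implied in $O(1/|j|)$ depend only on $\epsilon_1$ and $\gamma_1$. -/

import Mathlib

open Set

namespace InteriorTransmission

/-- `u`, with derivative `u'`, solves on `[0,1]` the initial value problem
`u'' + k² (ε + i γ / k) u = 0`, `u 0 = 0`, `u' 0 = 1`.
The potential is written in the expanded form `k² ε + i k γ`, which also makes sense at `k = 0`.
Derivatives at the end points are one-sided. -/
structure IsSolution (ε γ : ℝ → ℝ) (k : ℂ) (u u' : ℝ → ℂ) : Prop where
  hasDeriv : ∀ r ∈ Icc (0 : ℝ) 1, HasDerivWithinAt u (u' r) (Icc 0 1) r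
  hasDeriv' : ∀ r ∈ Icc (0 : ℝ) 1,
    HasDerivWithinAt u'
      (-((k ^ 2 * (ε r : ℂ) + Complex.I * k * (γ r : ℂ)) * u r)) (Icc 0 1) r
  init : u 0 = 0
  init' : u' 0 = 1

/-- `B = ∫₀¹ √ε`. -/
noncomputable def constB (ε : ℝ → ℝ) : ℝ := ∫ ρ in (0 : ℝ)..1, √(ε ρ)

/-- `D = ½ ∫₀¹ γ / √ε`. -/
noncomputable def constD (ε γ : ℝ → ℝ) : ℝ := 1 / 2 * ∫ ρ in (0 : ℝ)..1, γ ρ / √(ε ρ)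

/-- `f` is entire and the family `(z j)`, `j ∈ J`, lists all zeros of `f`, each one exactly as many
times as its multiplicity (and nothing else, since the order of `f` is `0` off its zeros). -/
def EnumeratesZeros (f : ℂ → ℂ) (J : Set ℤ) (z : ℤ → ℂ) : Prop :=
  Differentiable ℂ f ∧ ∀ w : ℂ, {j : ℤ | j ∈ J ∧ z j = w}.encard = analyticOrderAt f w

end InteriorTransmission

section

open Filter Topology InteriorTransmission

/-! For large k the equation is solved approximately by the Liouville–Green method. With q = √ε, p =
γ/(2√ε), a = ε^(-1/4), l = a'/a and ω = kq + ip one has k²ε + ikγ = ω² + p². The combinations X =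
a(u' + iωu - lu) and Y = a(u' - iωu - lu) then satisfy X' = iωX + g₁au and Y' = -iωY + g₂au with g₁,
g₂ free of k. Since au = (X - Y)/(2iω), the coupling is O(1/|k|), so X and Y stay close to a(0)
exp(±i∫ω). At r = 1 this makes k·y(1;k) and y'(1;k), up to nonzero constants, equal to sin(kB + iD)
and cos(kB + iD) with error O(e^{|Im k|B}/|k|) (`exists_liouville_green_bound`,
`exists_solution_asymptotics`).

Both functions are entire (`differentiable_solution`), and away from πℤ the sine dominates a
multiple of e^{|Im w|} (`le_norm_sin`). Rouché's theorem (`card_eq_card_of_norm_sub_lt`) therefore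
gives, in the variable w = kB + iD (+ π/2 for the cosine), one simple zero near jπ for each large
|j|, as many zeros as the sine in a large central disc, and none elsewhere. The lower bound for the
sine, applied at a zero, turns the error term into the distance O(1/|j|)
(`exists_zeros_near_int_mul_pi`).

For y(1;k) the comparison is with k·y(1;k), whose additional zero at the origin is discarded; hence
the index set ℤ∖{0}. For y'(1;k) the shift cos w = sin(w + π/2) produces j - 1/2. -/

/-! ### Factoring zeros out of entire functions -/

/-- Dividing an entire function that does not vanish identically by the full power of `z - a`. -/
lemma exists_entire_eq_pow_mul {f : ℂ → ℂ} (hf : Differentiable ℂ f) (hne : f ≠ 0) (a : ℂ) :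
    ∃ (n : ℕ) (g : ℂ → ℂ), Differentiable ℂ g ∧ g a ≠ 0 ∧ ∀ z, f z = (z - a) ^ n * g z := by
  obtain ⟨p, hp⟩ := hf.analyticAt a
  have hp0 : p ≠ 0 := by
    intro h
    have h0 := hp.locally_zero_iff.2 h
    exact hne ((AnalyticOnNhd.analyticOrderAt_eq_top_iff_eq_zero a fun z => hf.analyticAt z).1
      (analyticOrderAt_eq_top.2 h0))
  refine ⟨p.order, (Function.swap dslope a)^[p.order] f, ?_, hp.iterate_dslope_fslope_ne_zero hp0,
    fun z => by simpa using hp.eq_pow_order_mul_iterate_dslope z⟩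
  -- Entireness holds for every iterate of the divided difference, so the induction forgets that n
  -- is the order.
  generalize p.order = n
  induction n with
  | zero => simpa using hf
  | succ n ih =>
    rw [Function.iterate_succ_apply', ← differentiableOn_univ]
    exact (Complex.differentiableOn_dslope Filter.univ_mem).2 ih.differentiableOn

/-- The zeros of a nonzero entire function do not accumulate in a compact set. -/
lemma finite_zeros_inter_compact {f : ℂ → ℂ} (hf : Differentiable ℂ f) (hne : f ≠ 0) {K : Set ℂ}
    (hK : IsCompact K) : {z | z ∈ K ∧ f z = 0}.Finite := by
  by_contra hinf
  obtain ⟨x, -, hx⟩ := Set.Infinite.exists_accPt_of_subset_isCompact hinf hK fun z hz => hz.1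
  have h1 : ∃ᶠ z in 𝓝[≠] x, f z = 0 := (accPt_iff_frequently_nhdsNE.1 hx).mono fun z hz => hz.2
  exact hne ((AnalyticOnNhd.analyticOrderAt_eq_top_iff_eq_zero x fun z => hf.analyticAt z).1
      (analyticOrderAt_eq_top.2 ((hf.analyticAt x).frequently_zero_iff_eventually_zero.1 h1)))

/-- A nonzero entire function is a product of linear factors vanishing in a given compact set `K`
and an entire function without zeros in `K`. -/
lemma exists_multiset_factorization {f : ℂ → ℂ} (hf : Differentiable ℂ f) (hne : f ≠ 0) {K : Set ℂ}
    (hK : IsCompact K) :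
    ∃ (S : Multiset ℂ) (g : ℂ → ℂ), Differentiable ℂ g ∧ (∀ z ∈ K, g z ≠ 0) ∧ (∀ a ∈ S, a ∈ K) ∧
      ∀ z, f z = (S.map fun a => z - a).prod * g z := by
  have key : ∀ s : Finset ℂ, (∀ a ∈ s, a ∈ K) → ∃ (S : Multiset ℂ) (g : ℂ → ℂ),
      Differentiable ℂ g ∧ (∀ z ∈ s, g z ≠ 0) ∧ (∀ a ∈ S, a ∈ K) ∧
      ∀ z, f z = (S.map fun a => z - a).prod * g z := by
    intro s
    induction s using Finset.induction_on with
    | empty => exact fun _ => ⟨0, f, hf, by simp, by simp, by simp⟩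
    | insert a s ha ih =>
      intro hs
      obtain ⟨S, g, hg, hgs, hSK, hfac⟩ := ih fun b hb => hs b (Finset.mem_insert_of_mem hb)
      have hg0 : g ≠ 0 := by
        rintro rfl
        exact hne (funext fun z => by simp [hfac z])
      obtain ⟨n, h, hh, hha, hgh⟩ := exists_entire_eq_pow_mul hg hg0 a
      refine ⟨S + Multiset.replicate n a, h, hh, ?_, ?_, ?_⟩
      · intro z hz
        rcases Finset.mem_insert.1 hz with rfl | hz
        · exact hha
        · intro h0
          exact hgs z hz (by rw [hgh, h0, mul_zero])
      · intro b hb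
        rcases Multiset.mem_add.1 hb with hb | hb
        · exact hSK b hb
        · rw [Multiset.eq_of_mem_replicate hb]
          exact hs a (Finset.mem_insert_self _ _)
      · intro z
        rw [hfac, hgh]
        simp [mul_assoc]
  have hfin := finite_zeros_inter_compact hf hne hK
  obtain ⟨S, g, hg, hgs, hSK, hfac⟩ := key hfin.toFinset fun a ha => (hfin.mem_toFinset.1 ha).1
  refine ⟨S, g, hg, fun z hz h0 => ?_, hSK, hfac⟩
  -- A zero of g in K is a zero of f in K, so it was already divided out.
  exact hgs z (hfin.mem_toFinset.2 ⟨hz, by rw [hfac, h0, mul_zero]⟩) h0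

lemma differentiable_prod_sub (S : Multiset ℂ) :
    Differentiable ℂ fun z => (S.map fun a => z - a).prod := by
  induction S using Multiset.induction_on with
  | empty => simp
  | cons c S ih =>
    simp only [Multiset.map_cons, Multiset.prod_cons]
    fun_prop

/-- The multiplicity of a zero can be read off from a factorization. -/
lemma analyticOrderAt_eq_count {f g : ℂ → ℂ} {S : Multiset ℂ} (hg : Differentiable ℂ g)
    (hfac : ∀ z, f z = (S.map fun a => z - a).prod * g z) {a : ℂ} (ha : g a ≠ 0) :
    analyticOrderAt f a = S.count a := by
  induction S using Multiset.induction_on generalizing f with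
  | empty =>
    have : f = g := funext fun z => by simp [hfac z]
    rw [this]
    simpa using (hg.analyticAt a).analyticOrderAt_eq_zero.2 ha
  | cons b S ih =>
    have hf : f = (fun z => z - b) * fun z => (S.map fun a => z - a).prod * g z :=
      funext fun z => by simp [hfac z, mul_assoc]
    have hlin : AnalyticAt ℂ (fun z => z - b) a := by fun_prop
    have hrest : Differentiable ℂ fun z => (S.map fun a => z - a).prod * g z :=
      (differentiable_prod_sub S).mul hg
    rw [hf, analyticOrderAt_mul hlin (hrest.analyticAt a), ih fun z => rfl]
    by_cases hab : a = b
    · subst hab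
      have := analyticOrderAt_id_sub_const_self (𝕜 := ℂ) (c := a)
      simp only [Multiset.count_cons_self, Nat.cast_add, Nat.cast_one]
      rw [add_comm]
      congr 1
    · have : analyticOrderAt (fun z : ℂ => z - b) a = 0 :=
        hlin.analyticOrderAt_eq_zero.2 (sub_ne_zero.2 hab)
      rw [this, Multiset.count_cons_of_ne hab, zero_add]

/-! ### Argument principle and Rouché's theorem on circles -/

/-- The argument principle on a circle, for a function given in factored form. -/
lemma circleIntegral_logDeriv_eq_card {f g : ℂ → ℂ} {S : Multiset ℂ} {c : ℂ} {R : ℝ} (hR : 0 < R)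
    (hg : Differentiable ℂ g) (hg0 : ∀ z ∈ Metric.closedBall c R, g z ≠ 0)
    (hS : ∀ a ∈ S, a ∈ Metric.ball c R)
    (hfac : ∀ z, f z = (S.map fun a => z - a).prod * g z) :
    CircleIntegrable (logDeriv f) c R ∧
      ∮ z in C(c, R), logDeriv f z = 2 * Real.pi * Complex.I * S.card := by
  have hcont : ContinuousOn (logDeriv g) (Metric.closedBall c R) := by
    have h1 : Continuous (deriv g) := (hg.contDiff (n := 1)).continuous_deriv le_rfl
    exact h1.continuousOn.div hg.continuous.continuousOn hg0
  induction S using Multiset.induction_on generalizing f with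
  | empty =>
    have : f = g := funext fun z => by simp [hfac z]
    rw [this]
    refine ⟨(hcont.mono Metric.sphere_subset_closedBall).circleIntegrable hR.le, ?_⟩
    simp only [Multiset.card_zero, Nat.cast_zero, mul_zero]
    -- The zero-free factor has a holomorphic logarithmic derivative on the disc, so Cauchy's
    -- theorem applies.
    refine Complex.circleIntegral_eq_zero_of_differentiable_on_off_countable hR.le
      Set.countable_empty hcont fun z hz => ?_
    have hd : Differentiable ℂ (deriv g) :=
      (hg.contDiff (n := 2)).differentiable_deriv_two
    exact (hd z).div (hg z) (hg0 z (Metric.ball_subset_closedBall hz.1))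
  | cons b S ih =>
    have hb := hS b (Multiset.mem_cons_self b S)
    have hS' : ∀ a ∈ S, a ∈ Metric.ball c R := fun a ha => hS a (Multiset.mem_cons_of_mem ha)
    set h : ℂ → ℂ := fun z => (S.map fun a => z - a).prod * g z with hh
    obtain ⟨i1, e1⟩ := ih (f := h) hS' fun z => rfl
    have hf : f = fun z => (z - b) * h z :=
      funext fun z => by simp [hfac z, hh, mul_assoc]
    have hne : ∀ z ∈ Metric.sphere c R, z - b ≠ 0 := by
      intro z hz h0
      rw [sub_eq_zero.1 h0] at hz
      exact (Metric.mem_ball.1 hb).ne (Metric.mem_sphere.1 hz)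
    have hlog : ∀ z ∈ Metric.sphere c R, logDeriv f z = (z - b)⁻¹ + logDeriv h z := by
      intro z hz
      have hz0 : h z ≠ 0 := by
        refine mul_ne_zero ?_ (hg0 z (Metric.sphere_subset_closedBall hz))
        rw [Ne, Multiset.prod_eq_zero_iff]
        simp only [Multiset.mem_map, not_exists, not_and]
        intro a ha h0
        have := Metric.mem_ball.1 (hS' a ha)
        rw [← sub_eq_zero.1 h0] at this
        exact this.ne (Metric.mem_sphere.1 hz)
      have := logDeriv_mul (f := fun z => z - b) (g := h) z (hne z hz) hz0 (by fun_prop)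
        (((differentiable_prod_sub S).mul hg) z)
      rw [hf, this]
      simp [logDeriv_apply]
    have hi : CircleIntegrable (fun z => (z - b)⁻¹) c R := by
      refine ContinuousOn.circleIntegrable hR.le ?_
      exact ContinuousOn.inv₀ (by fun_prop) hne
    constructor
    · exact (circleIntegrable_congr (by rwa [abs_of_pos hR])).2 (hi.add i1)
    · rw [circleIntegral.integral_congr hR.le hlog, circleIntegral.integral_add hi i1, e1,
        circleIntegral.integral_sub_inv_of_mem_ball hb]
      simp; ring

/-- Rouché's theorem on a circle, for functions given in factored form. -/
theorem card_eq_card_of_norm_sub_lt {f₁ f₂ g₁ g₂ : ℂ → ℂ} {S₁ S₂ : Multiset ℂ} {c : ℂ} {R : ℝ}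
    (hR : 0 < R) (hg₁ : Differentiable ℂ g₁) (hg₂ : Differentiable ℂ g₂)
    (h₁ : ∀ z ∈ Metric.closedBall c R, g₁ z ≠ 0) (h₂ : ∀ z ∈ Metric.closedBall c R, g₂ z ≠ 0)
    (hS₁ : ∀ a ∈ S₁, a ∈ Metric.closedBall c R) (hS₂ : ∀ a ∈ S₂, a ∈ Metric.closedBall c R)
    (hfac₁ : ∀ z, f₁ z = (S₁.map fun a => z - a).prod * g₁ z)
    (hfac₂ : ∀ z, f₂ z = (S₂.map fun a => z - a).prod * g₂ z)
    (hlt : ∀ z ∈ Metric.sphere c R, ‖f₁ z - f₂ z‖ < ‖f₂ z‖) : S₁.card = S₂.card := by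
  have hne₂ : ∀ z ∈ Metric.sphere c R, f₂ z ≠ 0 := fun z hz h0 => by
    have := hlt z hz
    rw [h0, norm_zero] at this
    exact absurd this (norm_nonneg _).not_gt
  have hne₁ : ∀ z ∈ Metric.sphere c R, f₁ z ≠ 0 := fun z hz h0 => by
    have := hlt z hz
    rw [h0, zero_sub, norm_neg] at this
    exact lt_irrefl _ this
  -- Strict domination forbids zeros on the circle, so all listed zeros lie in the open disc.
  have inner : ∀ {f g : ℂ → ℂ} {S : Multiset ℂ}, (∀ z ∈ Metric.sphere c R, f z ≠ 0) →
      (∀ a ∈ S, a ∈ Metric.closedBall c R) → (∀ z, f z = (S.map fun a => z - a).prod * g z) →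
      ∀ a ∈ S, a ∈ Metric.ball c R := by
    intro f g S hf hS hfac a ha
    refine lt_of_le_of_ne (hS a ha) fun h => hf a h ?_
    rw [hfac, mul_eq_zero, Multiset.prod_eq_zero_iff]
    exact Or.inl (Multiset.mem_map.2 ⟨a, ha, sub_self a⟩)
  have hf₁ : Differentiable ℂ f₁ := by
    rw [funext hfac₁]; exact (differentiable_prod_sub S₁).mul hg₁
  have hf₂ : Differentiable ℂ f₂ := by
    rw [funext hfac₂]; exact (differentiable_prod_sub S₂).mul hg₂
  obtain ⟨i₁, e₁⟩ := circleIntegral_logDeriv_eq_card hR hg₁ h₁ (inner hne₁ hS₁ hfac₁) hfac₁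
  obtain ⟨i₂, e₂⟩ := circleIntegral_logDeriv_eq_card hR hg₂ h₂ (inner hne₂ hS₂ hfac₂) hfac₂
  -- The quotient f₁/f₂ stays within distance 1 of 1, so the principal logarithm of it is a
  -- single-valued primitive along the circle.
  have hzero : ∮ z in C(c, R), (logDeriv f₁ z - logDeriv f₂ z) = 0 := by
    refine circleIntegral.integral_eq_zero_of_hasDerivWithinAt
      (f := fun z => Complex.log (f₁ z / f₂ z)) hR.le fun z hz => ?_
    have hslit : f₁ z / f₂ z ∈ Complex.slitPlane := by
      have h1 : ‖f₁ z / f₂ z - 1‖ < 1 := by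
        rw [div_sub_one (hne₂ z hz), norm_div, div_lt_one (norm_pos_iff.2 (hne₂ z hz))]
        exact hlt z hz
      have := Complex.mem_slitPlane_of_norm_lt_one h1
      simpa using this
    have hd := ((hf₁ z).hasDerivAt.div (hf₂ z).hasDerivAt (hne₂ z hz)).clog hslit
    refine HasDerivAt.hasDerivWithinAt (hd.congr_deriv ?_)
    have a1 := hne₁ z hz
    have a2 := hne₂ z hz
    simp only [logDeriv_apply, Pi.div_apply]
    field_simp
  rw [circleIntegral.integral_sub i₁ i₂, e₁, e₂, ← mul_sub] at hzero
  have h2 := (mul_eq_zero.1 hzero).resolve_left Complex.two_pi_I_ne_zero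
  exact_mod_cast sub_eq_zero.1 h2

/-! ### Lower bounds for the sine and the location of its zeros -/

/-- Away from its zeros the sine is comparable to `exp |Im w|`. -/
lemma le_norm_sin {w : ℂ} {d : ℝ} (hd : d ≤ 1)
    (h : ∀ j : ℤ, d ≤ ‖w - j * Real.pi‖) : d / 6 * Real.exp |w.im| ≤ ‖Complex.sin w‖ := by
  have hπ := Real.pi_pos
  set j : ℤ := round (w.re / Real.pi) with hj
  set v : ℂ := w - j * Real.pi with hv
  have hsin : ‖Complex.sin w‖ = ‖Complex.sin v‖ := by
    rw [hv, Complex.sin_antiperiodic.sub_int_mul_eq, norm_mul]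
    simp
  have him : v.im = w.im := by simp [hv]
  have hre : |v.re| ≤ Real.pi / 2 := by
    have h1 := abs_sub_round (w.re / Real.pi)
    have h2 : v.re = (w.re / Real.pi - j) * Real.pi := by
      simp [hv]; field_simp
    rw [h2, abs_mul, abs_of_pos hπ]
    nlinarith
  -- The identity |sin(x + iy)|² = sin²x + sinh²y, used for v reduced to |x| ≤ π/2. If |y| ≥ 1, the
  -- sinh term alone gives e^{|y|}/4. If |y| ≤ 1, then e^{|y|} ≤ 3 and |sin v| ≥ |v|/2, which is
  -- what fixes the constant 1/6.
  have hsq : ‖Complex.sin v‖ ^ 2 = Real.sin v.re ^ 2 + Real.sinh v.im ^ 2 := by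
    have h1 : Complex.sin v = ⟨Real.sin v.re * Real.cosh v.im, Real.cos v.re * Real.sinh v.im⟩ := by
      rw [Complex.sin_eq]
      apply Complex.ext <;> simp [← Complex.ofReal_sin, ← Complex.ofReal_cos,
        ← Complex.ofReal_sinh, ← Complex.ofReal_cosh]
    rw [h1, ← Complex.normSq_eq_norm_sq, Complex.normSq_mk]
    have := Real.cosh_sq v.im
    have h3 := Real.sin_sq_add_cos_sq v.re
    linear_combination (Real.sin v.re) ^ 2 * this + (Real.sinh v.im) ^ 2 * h3
  have hdv : d ≤ ‖v‖ := h j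
  rw [hsin, ← him]
  have hsinh : |Real.sinh v.im| = Real.sinh |v.im| := by rw [Real.abs_sinh]
  rcases le_total 1 |v.im| with hy | hy
  · have h1 : Real.exp |v.im| / 4 ≤ Real.sinh |v.im| := by
      rw [Real.sinh_eq]
      have e1 : Real.exp (-|v.im|) ≤ 1 := Real.exp_le_one_iff.2 (by simp)
      have e2 : 1 + |v.im| ≤ Real.exp |v.im| := by linarith [Real.add_one_le_exp |v.im|]
      linarith
    have h2 : Real.sinh |v.im| ≤ ‖Complex.sin v‖ := by
      rw [← hsinh]
      refine abs_le_of_sq_le_sq' ?_ (norm_nonneg _) |>.2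
      rw [sq_abs, hsq]
      nlinarith [sq_nonneg (Real.sin v.re)]
    have := Real.exp_pos |v.im|
    nlinarith
  · have he : Real.exp |v.im| ≤ 3 := by
      have := Real.exp_le_exp.2 hy
      linarith [Real.exp_one_lt_d9]
    have hs : 2 / Real.pi * |v.re| ≤ |Real.sin v.re| := Real.mul_abs_le_abs_sin hre
    have hh : |v.im| ≤ |Real.sinh v.im| := by
      rw [hsinh]; exact Real.self_le_sinh_iff.2 (abs_nonneg _)
    have hc : (1 : ℝ) / 2 ≤ 2 / Real.pi := by
      rw [div_le_div_iff₀ (by norm_num) hπ]; linarith [Real.pi_le_four]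
    have hs' : 1 / 2 * |v.re| ≤ |Real.sin v.re| :=
      le_trans (mul_le_mul_of_nonneg_right hc (abs_nonneg _)) hs
    have h1 : (‖v‖ / 2) ^ 2 ≤ ‖Complex.sin v‖ ^ 2 := by
      rw [hsq, div_pow, ← Complex.normSq_eq_norm_sq, Complex.normSq_apply, ← sq_abs (Real.sin _),
        ← sq_abs (Real.sinh _)]
      have a1 := pow_le_pow_left₀ (by positivity) hs' 2
      have a2 := pow_le_pow_left₀ (by positivity) hh 2
      rw [mul_pow, sq_abs] at a1
      rw [sq_abs] at a2
      nlinarith [sq_nonneg v.im]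
    have h2 := (abs_le_of_sq_le_sq' h1 (norm_nonneg _)).2
    rcases le_total 0 d with h0 | h0
    · nlinarith
    · have := Real.exp_pos |v.im|
      nlinarith [norm_nonneg v]

lemma analyticOrderAt_sin_int_mul_pi (j : ℤ) :
    analyticOrderAt Complex.sin (j * Real.pi) = 1 := by
  refine (Complex.differentiable_sin.analyticAt _).analyticOrderAt_eq_one_of_zero_deriv_ne_zero
    (Complex.sin_int_mul_pi j) ?_
  intro h
  have h1 := Complex.sin_sq_add_cos_sq (j * Real.pi)
  rw [Complex.deriv_sin] at h
  simp [Complex.sin_int_mul_pi j, h] at h1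

lemma int_mul_pi_injective : Function.Injective fun j : ℤ => (j : ℂ) * Real.pi := by
  intro i j h
  have := mul_right_cancel₀ (Complex.ofReal_ne_zero.2 Real.pi_ne_zero) h
  exact_mod_cast this

/-- The zeros of the sine in a set, as a multiset. -/
lemma eq_map_int_mul_pi {K : Set ℂ} {T : Multiset ℂ} (hT : ∀ a ∈ T, a ∈ K)
    (hc : ∀ a ∈ K, analyticOrderAt Complex.sin a = T.count a) {J : Finset ℤ}
    (hJ : ∀ j : ℤ, j ∈ J ↔ (j : ℂ) * Real.pi ∈ K) :
    T = J.val.map fun j : ℤ => (j : ℂ) * Real.pi := by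
  have hnd : (J.val.map fun j : ℤ => (j : ℂ) * Real.pi).Nodup :=
    J.nodup.map int_mul_pi_injective
  ext a
  by_cases haK : a ∈ K
  · by_cases h0 : Complex.sin a = 0
    · obtain ⟨j, rfl⟩ := Complex.sin_eq_zero_iff.1 h0
      have h1 := hc _ haK
      rw [analyticOrderAt_sin_int_mul_pi] at h1
      rw [Multiset.count_eq_one_of_mem hnd (Multiset.mem_map.2 ⟨j, (hJ j).2 haK, rfl⟩)]
      exact_mod_cast h1.symm
    · have h1 := hc _ haK
      rw [(Complex.differentiable_sin.analyticAt _).analyticOrderAt_eq_zero.2 h0] at h1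
      rw [Multiset.count_eq_zero_of_notMem (s := J.val.map _)]
      · exact_mod_cast h1.symm
      · intro hm
        obtain ⟨j, -, rfl⟩ := Multiset.mem_map.1 hm
        exact h0 (Complex.sin_int_mul_pi j)
  · rw [Multiset.count_eq_zero_of_notMem fun h => haK (hT a h),
      Multiset.count_eq_zero_of_notMem]
    intro hm
    obtain ⟨j, hj, rfl⟩ := Multiset.mem_map.1 hm
    exact haK ((hJ j).1 hj)

/-- Removing one index and one element at a time lets finitely many zeros be labelled by any index
set of the right size. -/
lemma exists_map_eq_of_card_eq {α β : Type*} [DecidableEq α] [Nonempty β] (J : Finset α)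
    (S : Multiset β) (h : S.card = J.card) : ∃ f : α → β, J.val.map f = S := by
  induction J using Finset.induction_on generalizing S with
  | empty => exact ⟨fun _ => Classical.arbitrary β, by simpa [eq_comm] using h⟩
  | insert a J ha ih =>
    rw [Finset.card_insert_of_notMem ha] at h
    obtain ⟨b, hb⟩ := Multiset.card_pos_iff_exists_mem.1 (by omega : 0 < S.card)
    obtain ⟨S, rfl⟩ := Multiset.exists_cons_of_mem hb
    obtain ⟨f, rfl⟩ := ih S (by simpa using h)
    refine ⟨Function.update f a b, ?_⟩
    rw [Finset.insert_val_of_notMem ha, Multiset.map_cons, Function.update_self]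
    congr 1
    refine Multiset.map_congr rfl fun x hx => Function.update_of_ne ?_ _ _
    rintro rfl
    exact ha hx

/-- Translates multiplicity in a multiset into fibre size, the form in which `EnumeratesZeros`
records it. -/
lemma encard_fiber_eq_count {α β : Type*} [DecidableEq β] {J : Finset α} {f : α → β}
    {S : Multiset β} (h : J.val.map f = S) (v : β) :
    {j | j ∈ J ∧ f j = v}.encard = S.count v := by
  have : {j | j ∈ J ∧ f j = v} = (J.filter fun j => v = f j : Finset α) := by
    ext j; simp [eq_comm]
  rw [this, Set.encard_coe_eq_coe_finsetCard, ← h, Multiset.count_map]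
  rfl

/-- Integer multiples of `π` are far apart. -/
lemma two_le_norm_sub_int_mul_pi {z : ℂ} {i j : ℤ} (hij : i ≠ j) (hz : ‖z - j * Real.pi‖ ≤ 1) :
    2 ≤ ‖z - i * Real.pi‖ := by
  have h1 : ‖((i : ℂ) - j) * Real.pi‖ ≤ ‖z - j * Real.pi‖ + ‖z - i * Real.pi‖ := by
    have := norm_sub_le (z - j * Real.pi) (z - i * Real.pi)
    rwa [show (z - j * Real.pi) - (z - i * Real.pi) = ((i : ℂ) - j) * Real.pi by ring] at this
  have h2 : (1 : ℝ) ≤ ‖(i : ℂ) - j‖ := by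
    have : (1 : ℤ) ≤ |i - j| := Int.one_le_abs (sub_ne_zero.2 hij)
    have h3 : ‖(i : ℂ) - j‖ = |((i - j : ℤ) : ℝ)| := by
      rw [← Complex.norm_intCast]; push_cast; rfl
    rw [h3]
    exact_mod_cast this
  rw [norm_mul, Complex.norm_real, Real.norm_of_nonneg Real.pi_pos.le] at h1
  nlinarith [Real.pi_gt_three]

lemma norm_int_mul_pi (j : ℤ) : ‖(j : ℂ) * Real.pi‖ = |(j : ℝ)| * Real.pi := by
  rw [norm_mul, Complex.norm_real, Real.norm_of_nonneg Real.pi_pos.le, Complex.norm_intCast]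

/-- Points on the circles of radius `(N + 1/2) π` are far from the zeros of the sine. -/
lemma one_le_norm_sub_of_norm_eq {z : ℂ} {N : ℕ} (hz : ‖z‖ = (N + 1 / 2) * Real.pi) (j : ℤ) :
    1 ≤ ‖z - j * Real.pi‖ := by
  have h1 := abs_norm_sub_norm_le z (j * Real.pi)
  rw [hz, norm_int_mul_pi, ← sub_mul, abs_mul, abs_of_pos Real.pi_pos] at h1
  -- The number |j| is an integer, so it is at least 1/2 away from N + 1/2; multiplying by π > 3
  -- gives more than 1.
  have h2 : (1 : ℝ) / 2 ≤ abs (N + 1 / 2 - abs (j : ℝ)) := by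
    have h4 : |(j : ℝ)| = ((j.natAbs : ℕ) : ℝ) := by simp
    rw [h4]
    rcases le_or_gt j.natAbs N with h | h
    · have : ((j.natAbs : ℕ) : ℝ) ≤ N := by exact_mod_cast h
      rw [le_abs]; left; linarith
    · have : (N : ℝ) + 1 ≤ ((j.natAbs : ℕ) : ℝ) := by exact_mod_cast h
      rw [le_abs]; right; linarith
  nlinarith [Real.pi_gt_three]

/-! ### Zeros of entire functions asymptotic to the sine -/

/-- An entire function that is close to the sine on a circle far from `π ℤ` has the same number
of zeros inside that circle. -/
lemma exists_zeros_closedBall {F : ℂ → ℂ} (hF : Differentiable ℂ F) (hne : F ≠ 0) {c : ℂ} {R : ℝ}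
    (hR : 0 < R) (hlt : ∀ z ∈ Metric.sphere c R, ‖F z - Complex.sin z‖ < ‖Complex.sin z‖)
    {J : Finset ℤ} (hJ : ∀ j : ℤ, j ∈ J ↔ (j : ℂ) * Real.pi ∈ Metric.closedBall c R) :
    ∃ S : Multiset ℂ, S.card = J.card ∧ (∀ a ∈ S, a ∈ Metric.closedBall c R) ∧
      ∀ a ∈ Metric.closedBall c R, analyticOrderAt F a = S.count a := by
  have hs : (Complex.sin : ℂ → ℂ) ≠ 0 := by
    intro h
    have := congrFun h (Real.pi / 2)
    simp at this
  have hK := isCompact_closedBall c R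
  obtain ⟨S, g, hg, hg0, hSK, hfac⟩ := exists_multiset_factorization hF hne hK
  obtain ⟨T, g', hg', hg0', hTK, hfac'⟩ :=
    exists_multiset_factorization Complex.differentiable_sin hs hK
  refine ⟨S, ?_, hSK, fun a ha => analyticOrderAt_eq_count hg hfac (hg0 a ha)⟩
  rw [card_eq_card_of_norm_sub_lt hR hg hg' hg0 hg0' hSK hTK hfac hfac' hlt,
    eq_map_int_mul_pi hTK (fun a ha => analyticOrderAt_eq_count hg' hfac' (hg0' a ha)) hJ]
  simp

/-- An entire function asymptotic to the sine has its zeros asymptotic to `π ℤ`. -/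
theorem exists_zeros_near_int_mul_pi {F : ℂ → ℂ} (hF : Differentiable ℂ F) {C : ℝ}
    (hb : ∀ w, ‖F w - Complex.sin w‖ ≤ C / (1 + ‖w‖) * Real.exp |w.im|) :
    ∃ z : ℤ → ℂ, (∀ v, {j | z j = v}.encard = analyticOrderAt F v) ∧
      ∃ C' : ℝ, ∀ j : ℤ, j ≠ 0 → ‖z j - j * Real.pi‖ ≤ C' / |(j : ℝ)| := by
  classical
  have hC : 0 ≤ C := by
    have h0 := (norm_nonneg _).trans (hb 0)
    simpa using h0
  have hπ := Real.pi_gt_three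
  -- The threshold 6C matches the constant 1/6 in `le_norm_sin`: beyond norm N the error is smaller
  -- than the sine at distance 1 from πℤ.
  obtain ⟨N, hN⟩ := exists_nat_ge (6 * C)
  have hsmall : ∀ w : ℂ, (N : ℝ) ≤ ‖w‖ → C / (1 + ‖w‖) < 1 / 6 := by
    intro w hw
    rw [div_lt_div_iff₀ (by positivity) (by norm_num)]
    linarith
  have hlt : ∀ w : ℂ, (N : ℝ) ≤ ‖w‖ → (∀ j : ℤ, 1 ≤ ‖w - j * Real.pi‖) →
      ‖F w - Complex.sin w‖ < ‖Complex.sin w‖ := fun w hw hj =>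
    (hb w).trans_lt ((mul_lt_mul_of_pos_right (hsmall w hw) (Real.exp_pos _)).trans_le
      (le_norm_sin le_rfl hj))
  have hNR : (N : ℝ) ≤ (N + 1 / 2) * Real.pi := by
    have : (0 : ℝ) ≤ N := N.cast_nonneg
    nlinarith
  have hne : F ≠ 0 := by
    rintro rfl
    have hw : ‖(((N + 1 / 2) * Real.pi : ℝ) : ℂ)‖ = (N + 1 / 2) * Real.pi := by
      rw [Complex.norm_real, Real.norm_of_nonneg (by positivity)]
    have := hlt _ (hw.symm ▸ hNR : (N : ℝ) ≤ _) (one_le_norm_sub_of_norm_eq hw)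
    simp at this
  -- At a zero of F the sine equals the error in modulus, and cancelling e^{|Im v|} bounds the
  -- distance to πℤ. With d = 1 this excludes stray zeros; with d the actual distance it gives the
  -- rate.
  have hzero : ∀ v, F v = 0 → ∀ d ≤ 1, (∀ j : ℤ, d ≤ ‖v - j * Real.pi‖) →
      d ≤ 6 * C / (1 + ‖v‖) := by
    intro v hv d hd hj
    have h1 := (le_norm_sin hd hj).trans (by simpa [hv] using hb v)
    have h2 := le_of_mul_le_mul_right h1 (Real.exp_pos _)
    rw [mul_div_assoc]
    linarith
  -- Rouché on the unit circle about jπ, which encloses no other multiple of π: exactly one zero,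
  -- and a simple one.
  have hloc : ∀ j : ℤ, (N : ℤ) < |j| → ∃ a : ℂ, ‖a - j * Real.pi‖ ≤ 1 ∧
      ∀ v : ℂ, ‖v - j * Real.pi‖ ≤ 1 → analyticOrderAt F v = if v = a then 1 else 0 := by
    intro j hj
    have hj' : (N : ℝ) + 1 ≤ |(j : ℝ)| := by exact_mod_cast hj
    obtain ⟨S, hS1, hSK, hSc⟩ := exists_zeros_closedBall hF hne (c := j * Real.pi) (R := 1)
      one_pos (J := {j}) (fun z hz => by
        rw [mem_sphere_iff_norm] at hz
        refine hlt z ?_ fun i => ?_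
        · have h1 := norm_sub_norm_le (j * Real.pi : ℂ) z
          rw [norm_sub_rev, hz, norm_int_mul_pi] at h1
          nlinarith [N.cast_nonneg (α := ℝ)]
        · by_cases hij : i = j
          · rw [hij, hz]
          · linarith [two_le_norm_sub_int_mul_pi hij hz.le]) (fun i => by
        rw [Finset.mem_singleton, mem_closedBall_iff_norm]
        constructor
        · rintro rfl; simp
        · intro h
          by_contra hij
          have := two_le_norm_sub_int_mul_pi hij h
          simp at this
          linarith)
    rw [Finset.card_singleton, Multiset.card_eq_one] at hS1
    obtain ⟨a, rfl⟩ := hS1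
    refine ⟨a, mem_closedBall_iff_norm.1 (hSK a (by simp)), fun v hv => ?_⟩
    rw [hSc v (mem_closedBall_iff_norm.2 hv), Multiset.count_singleton]
    split_ifs <;> simp
  choose! a ha ha' using hloc
  -- The radius lies midway between Nπ and (N + 1)π, so the central disc contains precisely the jπ
  -- with |j| ≤ N.
  obtain ⟨S, hScard, hSK, hSc⟩ := exists_zeros_closedBall hF hne (c := 0)
    (R := (N + 1 / 2) * Real.pi) (by positivity) (J := Finset.Icc (-N : ℤ) N) (fun z hz => by
      have hz' : ‖z‖ = (N + 1 / 2) * Real.pi := by simpa using hz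
      exact hlt z (hz'.symm ▸ hNR : (N : ℝ) ≤ _) (one_le_norm_sub_of_norm_eq hz')) (fun j => by
      rw [Finset.mem_Icc, ← abs_le, mem_closedBall_zero_iff, norm_int_mul_pi,
        mul_le_mul_iff_left₀ Real.pi_pos]
      constructor
      · intro h
        have : |(j : ℝ)| ≤ N := by exact_mod_cast h
        linarith
      · intro h
        by_contra! h'
        have : (N : ℝ) + 1 ≤ |(j : ℝ)| := by exact_mod_cast h'
        linarith)
  obtain ⟨f, hf⟩ := exists_map_eq_of_card_eq _ S hScard
  -- Outer unit discs miss the central disc, since π/2 > 1; the second bound converts 1/(1 + ‖v‖)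
  -- into 1/|j|.
  have hfar : ∀ j : ℤ, (N : ℤ) < |j| → ∀ v : ℂ, ‖v - j * Real.pi‖ ≤ 1 →
      (N + 1 / 2) * Real.pi < ‖v‖ ∧ |(j : ℝ)| ≤ 1 + ‖v‖ := by
    intro j hj v hv
    have hj' : (N : ℝ) + 1 ≤ |(j : ℝ)| := by exact_mod_cast hj
    have h1 := norm_sub_norm_le (j * Real.pi : ℂ) v
    rw [norm_sub_rev, norm_int_mul_pi] at h1
    constructor <;> nlinarith [N.cast_nonneg (α := ℝ)]
  have hord0 : ∀ v, F v ≠ 0 → analyticOrderAt F v = 0 := fun v hv =>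
    (hF.analyticAt v).analyticOrderAt_eq_zero.2 hv
  have hazero : ∀ j : ℤ, (N : ℤ) < |j| → F (a j) = 0 := by
    intro j hj
    by_contra h
    have := ha' j hj (a j) (ha j hj)
    rw [hord0 _ h, if_pos rfl] at this
    exact zero_ne_one this
  -- Zeros of the central disc are labelled arbitrarily by |j| ≤ N; every other index gets the zero
  -- of its own unit disc.
  set z : ℤ → ℂ := fun j => if |j| ≤ N then f j else a j with hz
  refine ⟨z, fun v => ?_, ?_⟩
  · rcases le_or_gt ‖v‖ ((N + 1 / 2) * Real.pi) with hv | hv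
    · rw [hSc v (by simpa using hv), ← encard_fiber_eq_count hf v]
      congr 1
      ext j
      simp only [mem_ofPred_eq, Finset.mem_Icc, ← abs_le]
      by_cases hj : |j| ≤ N
      · simp [hz, hj]
      · simp only [hz, hj, if_false, false_and, iff_false]
        rintro rfl
        exact hv.not_gt (hfar j (not_le.1 hj) _ (ha j (not_le.1 hj))).1
    · have hfS : ∀ j : ℤ, |j| ≤ N → f j ≠ v := by
        rintro j hj rfl
        have : f j ∈ S := by
          rw [← hf]
          exact Multiset.mem_map_of_mem f (Finset.mem_Icc.2 (abs_le.1 hj))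
        exact hv.not_ge (by simpa using hSK _ this)
      by_cases h0 : F v = 0
      · obtain ⟨j, hj⟩ : ∃ j : ℤ, ‖v - j * Real.pi‖ < 1 := by
          by_contra! h
          have h1 := hzero v h0 1 le_rfl h
          have h2 := hsmall v (hNR.trans hv.le)
          rw [mul_div_assoc] at h1
          linarith
        have hjN : (N : ℤ) < |j| := by
          by_contra! h'
          have h3 : |(j : ℝ)| ≤ N := by exact_mod_cast h'
          have h1 := norm_sub_norm_le v (j * Real.pi : ℂ)
          rw [norm_int_mul_pi] at h1
          nlinarith
        have hva : v = a j := by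
          by_contra hne'
          have := ha' j hjN v hj.le
          rw [if_neg hne'] at this
          exact (hF.analyticAt v).analyticOrderAt_ne_zero.2 h0 this
        rw [ha' j hjN v hj.le, if_pos hva]
        rw [Set.encard_eq_one]
        refine ⟨j, ?_⟩
        ext i
        simp only [mem_ofPred_eq, mem_singleton_iff]
        constructor
        · intro hi
          have hiN : (N : ℤ) < |i| := by
            by_contra! h'
            exact hfS i h' (by simpa [hz, h'] using hi)
          have hai : a i = v := by simpa [hz, hiN.not_ge] using hi
          by_contra hij
          have h1 := two_le_norm_sub_int_mul_pi hij hj.le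
          have h2 := ha i hiN
          rw [hai] at h2
          linarith
        · rintro rfl
          simp [hz, hjN.not_ge, hva]
      · rw [hord0 v h0, Set.encard_eq_zero, Set.eq_empty_iff_forall_notMem]
        intro j hj
        by_cases hjN : |j| ≤ N
        · exact hfS j hjN (by simpa [hz, hjN] using hj)
        · have : a j = v := by simpa [hz, hjN] using hj
          exact h0 (this ▸ hazero j (not_le.1 hjN))
  -- The finite sum absorbs the arbitrary labelling for |j| ≤ N; 6C serves all other indices.
  · refine ⟨6 * C + ∑ j ∈ Finset.Icc (-N : ℤ) N, ‖f j - j * Real.pi‖ * |(j : ℝ)|,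
      fun j hj0 => ?_⟩
    have hjpos : 0 < |(j : ℝ)| := abs_pos.2 (Int.cast_ne_zero.2 hj0)
    rw [le_div_iff₀ hjpos]
    have hsum : 0 ≤ ∑ j ∈ Finset.Icc (-N : ℤ) N, ‖f j - j * Real.pi‖ * |(j : ℝ)| :=
      Finset.sum_nonneg fun _ _ => by positivity
    by_cases hjN : |j| ≤ N
    · have h1 := Finset.single_le_sum
        (f := fun j : ℤ => ‖f j - j * Real.pi‖ * |(j : ℝ)|) (fun _ _ => by positivity)
        (Finset.mem_Icc.2 (abs_le.1 hjN))
      simp only [hz, hjN, if_true]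
      linarith
    · have hj := not_le.1 hjN
      simp only [hz, hjN, if_false]
      have h1 := hzero _ (hazero j hj) ‖a j - j * Real.pi‖ (ha j hj) fun i => by
        by_cases hij : i = j
        · rw [hij]
        · linarith [two_le_norm_sub_int_mul_pi hij (ha j hj), ha j hj]
      rw [le_div_iff₀ (by positivity)] at h1
      have h2 := (hfar j hj _ (ha j hj)).2
      nlinarith [norm_nonneg (a j - j * Real.pi)]

/-! ### Holomorphic dependence of the solution on k -/

/-- A priori bound for a second order linear initial value problem on `[0,1]`. -/
lemma norm_le_of_linear_ivp {u u' Q g : ℝ → ℂ} {M δ η : ℝ} (hM : 1 ≤ M)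
    (hu : ∀ r ∈ Icc (0 : ℝ) 1, HasDerivWithinAt u (u' r) (Icc 0 1) r)
    (hu' : ∀ r ∈ Icc (0 : ℝ) 1, HasDerivWithinAt u' (-(Q r * u r) + g r) (Icc 0 1) r)
    (h0 : ‖u 0‖ ≤ η) (h0' : ‖u' 0‖ ≤ η)
    (hQ : ∀ r ∈ Icc (0 : ℝ) 1, ‖Q r‖ ≤ M) (hg : ∀ r ∈ Icc (0 : ℝ) 1, ‖g r‖ ≤ δ) :
    ∀ r ∈ Icc (0 : ℝ) 1, ‖u r‖ ≤ (η + δ) * Real.exp M ∧ ‖u' r‖ ≤ (η + δ) * Real.exp M := by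
  intro r hr
  have hδ : 0 ≤ δ := (norm_nonneg _).trans (hg r hr)
  have hη : 0 ≤ η := (norm_nonneg _).trans h0
  have hd : ∀ x ∈ Icc (0 : ℝ) 1, HasDerivWithinAt (fun x => (u x, u' x))
      (u' x, -(Q x * u x) + g x) (Icc 0 1) x := fun x hx => (hu x hx).prodMk (hu' x hx)
  -- Grönwall for the pair (u, u') in the sup norm; M ≥ 1 lets the same constant also cover the
  -- component u'.
  have key := norm_le_gronwallBound_of_norm_deriv_right_le (f := fun x => (u x, u' x))
    (f' := fun x => (u' x, -(Q x * u x) + g x)) (δ := η) (K := M) (ε := δ) (a := 0) (b := 1)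
    (fun x hx => (hd x hx).continuousWithinAt)
    (fun x hx => (hd x (Ico_subset_Icc_self hx)).mono_of_mem_nhdsWithin
      (Icc_mem_nhdsGE_of_mem hx)) (max_le h0 h0') (fun x hx => by
      have hx' := Ico_subset_Icc_self hx
      have n1 : ‖u x‖ ≤ ‖(u x, u' x)‖ := norm_fst_le (u x, u' x)
      have n2 : ‖u' x‖ ≤ ‖(u x, u' x)‖ := norm_snd_le (u x, u' x)
      refine max_le ?_ ?_
      · have := mul_le_mul_of_nonneg_right hM (norm_nonneg (u x, u' x))
        dsimp only
        linarith
      · refine (norm_add_le _ _).trans (add_le_add ?_ (hg x hx'))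
        rw [norm_neg, norm_mul]
        exact mul_le_mul (hQ x hx') n1 (norm_nonneg _) (by linarith)) r hr
  have hb : gronwallBound η M δ (r - 0) ≤ (η + δ) * Real.exp M := by
    rw [gronwallBound_of_K_ne_0 (by linarith)]
    have e1 : Real.exp (M * (r - 0)) ≤ Real.exp M :=
      Real.exp_le_exp.2 (by nlinarith [hr.1, hr.2])
    have e2 : δ / M ≤ δ := div_le_self hδ hM
    have e3 : δ / M * (Real.exp (M * (r - 0)) - 1) ≤ δ * Real.exp M := by
      have h1 : (1 : ℝ) ≤ Real.exp (M * (r - 0)) :=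
        Real.one_le_exp (mul_nonneg (by linarith) (by linarith [hr.1]))
      exact mul_le_mul e2 (by linarith) (by linarith) hδ
    have e4 := mul_le_mul_of_nonneg_left e1 hη
    simp only
    linarith
  exact ⟨(norm_fst_le (u r, u' r)).trans (key.trans hb),
    (norm_snd_le (u r, u' r)).trans (key.trans hb)⟩

/-- A function whose difference quotients are Cauchy is differentiable. -/
lemma differentiableAt_of_slope_cauchy {f : ℂ → ℂ} {a : ℂ} {C : ℝ}
    (h : ∀ k l, k ≠ a → l ≠ a → ‖k - a‖ ≤ 1 → ‖l - a‖ ≤ 1 →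
      ‖slope f a k - slope f a l‖ ≤ C * (‖k - a‖ + ‖l - a‖)) : DifferentiableAt ℂ f a := by
  have hc : Cauchy (map (slope f a) (𝓝[≠] a)) := by
    rw [Metric.cauchy_iff]
    refine ⟨inferInstance, fun ε hε => ?_⟩
    set δ : ℝ := min 1 (ε / (2 * (|C| + 1))) with hδ
    have hδ0 : 0 < δ := lt_min one_pos (by positivity)
    refine ⟨slope f a '' (Metric.ball a δ ∩ {a}ᶜ),
      image_mem_map (inter_mem (mem_nhdsWithin_of_mem_nhds (Metric.ball_mem_nhds a hδ0))
        self_mem_nhdsWithin), ?_⟩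
    rintro _ ⟨k, ⟨hk, hka⟩, rfl⟩ _ ⟨l, ⟨hl, hla⟩, rfl⟩
    rw [mem_ball_iff_norm] at hk hl
    have h1 := h k l hka hla (hk.le.trans (min_le_left _ _)) (hl.le.trans (min_le_left _ _))
    rw [dist_eq_norm]
    refine h1.trans_lt ?_
    have h2 : ‖k - a‖ + ‖l - a‖ < ε / (|C| + 1) := by
      have hk' := hk.trans_le (min_le_right _ _)
      have hl' := hl.trans_le (min_le_right _ _)
      have : ε / (2 * (|C| + 1)) + ε / (2 * (|C| + 1)) = ε / (|C| + 1) := by field_simp; ring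
      linarith
    rw [lt_div_iff₀ (by positivity)] at h2
    have h3 : 0 ≤ ‖k - a‖ + ‖l - a‖ := by positivity
    rcases h3.eq_or_lt with h4 | h4
    · rw [← h4, mul_zero]; exact hε
    · nlinarith [le_abs_self C]
  obtain ⟨d, hd⟩ := CompleteSpace.complete hc
  exact (hasDerivAt_iff_tendsto_slope.2 hd).differentiableAt

/-- The solution of the initial value problem and its derivative depend holomorphically on `k`. -/
theorem differentiable_solution {ε γ : ℝ → ℝ} (hε : ContinuousOn ε (Icc 0 1))
    (hγ : ContinuousOn γ (Icc 0 1)) {y y' : ℝ → ℂ → ℂ}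
    (hy : ∀ k : ℂ, IsSolution ε γ k (fun r => y r k) (fun r => y' r k)) {r : ℝ}
    (hr : r ∈ Icc (0 : ℝ) 1) :
    Differentiable ℂ (fun k => y r k) ∧ Differentiable ℂ (fun k => y' r k) := by
  obtain ⟨E₁, hE₁⟩ := isCompact_Icc.exists_bound_of_continuousOn hε
  obtain ⟨E₂, hE₂⟩ := isCompact_Icc.exists_bound_of_continuousOn hγ
  set E : ℝ := max E₁ E₂ with hE
  have hEε : ∀ r ∈ Icc (0 : ℝ) 1, ‖(ε r : ℂ)‖ ≤ E := fun r hr => by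
    rw [Complex.norm_real]; exact (hE₁ r hr).trans (le_max_left _ _)
  have hEγ : ∀ r ∈ Icc (0 : ℝ) 1, ‖(γ r : ℂ)‖ ≤ E := fun r hr => by
    rw [Complex.norm_real]; exact (hE₂ r hr).trans (le_max_right _ _)
  have hE0 : 0 ≤ E := (norm_nonneg _).trans (hEε r hr)
  have main : ∀ a : ℂ, ∃ C : ℝ, ∀ k l, k ≠ a → l ≠ a → ‖k - a‖ ≤ 1 → ‖l - a‖ ≤ 1 →
      ‖slope (fun k => y r k) a k - slope (fun k => y r k) a l‖ ≤ C * (‖k - a‖ + ‖l - a‖) ∧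
      ‖slope (fun k => y' r k) a k - slope (fun k => y' r k) a l‖
        ≤ C * (‖k - a‖ + ‖l - a‖) := by
    intro a
    set Q : ℂ → ℝ → ℂ := fun k r => k ^ 2 * (ε r : ℂ) + Complex.I * k * (γ r : ℂ) with hQdef
    -- For k ≠ a this is the difference quotient (Q k - Q a)/(k - a) of the potential, as `hQV`
    -- records.
    set V : ℂ → ℝ → ℂ := fun k r => (k + a) * (ε r : ℂ) + Complex.I * (γ r : ℂ) with hVdef
    set ρ : ℝ := ‖a‖ + 1 with hρ
    have hρ0 : 0 ≤ ρ := by positivity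
    set M : ℝ := 1 + ρ ^ 2 * E + ρ * E with hM
    have hM1 : 1 ≤ M := by
      have : 0 ≤ ρ ^ 2 * E + ρ * E := by positivity
      linarith
    set N : ℝ := 2 * ρ * E + E with hN
    have hN0 : 0 ≤ N := by positivity
    have hk : ∀ k : ℂ, ‖k - a‖ ≤ 1 → ‖k‖ ≤ ρ := fun k hk => by
      have := norm_sub_norm_le k a
      linarith
    have hQ : ∀ k : ℂ, ‖k - a‖ ≤ 1 → ∀ r ∈ Icc (0 : ℝ) 1, ‖Q k r‖ ≤ M := by
      intro k hka r hr
      have h1 := hk k hka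
      refine (norm_add_le _ _).trans ?_
      rw [norm_mul, norm_mul, norm_mul, norm_pow, Complex.norm_I, one_mul]
      have := mul_le_mul (pow_le_pow_left₀ (norm_nonneg k) h1 2) (hEε r hr) (norm_nonneg _)
        (by positivity)
      have := mul_le_mul h1 (hEγ r hr) (norm_nonneg _) hρ0
      linarith
    have hV : ∀ k : ℂ, ‖k - a‖ ≤ 1 → ∀ r ∈ Icc (0 : ℝ) 1, ‖V k r‖ ≤ N := by
      intro k hka r hr
      have h1 := hk k hka
      refine (norm_add_le _ _).trans ?_
      rw [norm_mul, norm_mul, Complex.norm_I, one_mul]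
      have h2 : ‖k + a‖ ≤ 2 * ρ := (norm_add_le _ _).trans (by linarith)
      have := mul_le_mul h2 (hEε r hr) (norm_nonneg _) (by positivity)
      linarith [hEγ r hr]
    have haa : ‖a - a‖ ≤ 1 := by simp
    have hQV : ∀ k r, Q k r = Q a r + (k - a) * V k r := fun k r => by
      simp only [hQdef, hVdef]; ring
    have hbd : ∀ k : ℂ, ‖k - a‖ ≤ 1 → ∀ r ∈ Icc (0 : ℝ) 1, ‖y r k‖ ≤ Real.exp M := by
      intro k hka r hr
      have := (norm_le_of_linear_ivp (g := fun _ => 0) (δ := 0) (η := 1) hM1 (hy k).hasDeriv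
        (fun r hr => by simpa using (hy k).hasDeriv' r hr) (by simp [(hy k).init])
        (by simp [(hy k).init']) (hQ k hka) (by simp) r hr).1
      simpa using this
    have hdiff : ∀ k : ℂ, ‖k - a‖ ≤ 1 → ∀ r ∈ Icc (0 : ℝ) 1,
        ‖y r k - y r a‖ ≤ ‖k - a‖ * N * Real.exp M * Real.exp M := by
      intro k hka r hr
      have := (norm_le_of_linear_ivp (u := fun r => y r k - y r a)
        (u' := fun r => y' r k - y' r a) (Q := Q a)
        (g := fun r => -((k - a) * V k r * y r k)) (δ := ‖k - a‖ * N * Real.exp M) (η := 0) hM1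
        (fun r hr => ((hy k).hasDeriv r hr).sub ((hy a).hasDeriv r hr))
        (fun r hr => (((hy k).hasDeriv' r hr).sub ((hy a).hasDeriv' r hr)).congr_deriv (by
          have := hQV k r
          simp only [hQdef] at this ⊢
          rw [this]; ring)) (by simp [(hy k).init, (hy a).init])
        (by simp [(hy k).init', (hy a).init']) (hQ a haa) (fun r hr => by
          rw [norm_neg, norm_mul, norm_mul]
          gcongr
          · exact hV k hka r hr
          · exact hbd k hka r hr) r hr).1
      simpa using this
    set W : ℝ := E * Real.exp M + N * (N * Real.exp M * Real.exp M) with hW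
    have hVy : ∀ k : ℂ, ‖k - a‖ ≤ 1 → ∀ r ∈ Icc (0 : ℝ) 1,
        ‖V k r * y r k - V a r * y r a‖ ≤ ‖k - a‖ * W := by
      intro k hka r hr
      have h1 : V k r * y r k - V a r * y r a
          = (k - a) * ε r * y r k + V a r * (y r k - y r a) := by
        simp only [hVdef]; ring
      rw [h1]
      refine (norm_add_le _ _).trans ?_
      rw [norm_mul, norm_mul, norm_mul]
      have e1 : ‖k - a‖ * ‖(ε r : ℂ)‖ * ‖y r k‖ ≤ ‖k - a‖ * E * Real.exp M := by
        gcongr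
        · exact hEε r hr
        · exact hbd k hka r hr
      have e2 : ‖V a r‖ * ‖y r k - y r a‖ ≤ N * (‖k - a‖ * N * Real.exp M * Real.exp M) := by
        gcongr
        · exact hV a haa r hr
        · exact hdiff k hka r hr
      calc _ ≤ _ := add_le_add e1 e2
        _ = _ := by rw [hW]; ring
    refine ⟨W * Real.exp M, fun k l hka hla hk1 hl1 => ?_⟩
    have hka' := sub_ne_zero.2 hka
    have hla' := sub_ne_zero.2 hla
    -- The difference of two slopes solves the equation at parameter a with zero initial data and a
    -- forcing that is Lipschitz-small in k - a and l - a, so the a priori bound gives the Cauchy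
    -- estimate.
    have := norm_le_of_linear_ivp
      (u := fun r => (k - a)⁻¹ * (y r k - y r a) - (l - a)⁻¹ * (y r l - y r a))
      (u' := fun r => (k - a)⁻¹ * (y' r k - y' r a) - (l - a)⁻¹ * (y' r l - y' r a)) (Q := Q a)
      (g := fun r => (V l r * y r l - V a r * y r a) - (V k r * y r k - V a r * y r a))
      (δ := ‖l - a‖ * W + ‖k - a‖ * W) (η := 0) hM1
      (fun r hr => ((((hy k).hasDeriv r hr).sub ((hy a).hasDeriv r hr)).const_mul _).sub
        ((((hy l).hasDeriv r hr).sub ((hy a).hasDeriv r hr)).const_mul _))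
      (fun r hr => (((((hy k).hasDeriv' r hr).sub ((hy a).hasDeriv' r hr)).const_mul _).sub
        ((((hy l).hasDeriv' r hr).sub ((hy a).hasDeriv' r hr)).const_mul _)).congr_deriv (by
          have h1 := hQV k r
          have h2 := hQV l r
          simp only [hQdef] at h1 h2 ⊢
          rw [h1, h2]; field_simp; ring))
      (by simp [(hy k).init, (hy a).init, (hy l).init])
      (by simp [(hy k).init', (hy a).init', (hy l).init']) (hQ a haa)
      (fun r hr => (norm_sub_le _ _).trans (add_le_add (hVy l hl1 r hr) (hVy k hk1 r hr))) r hr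
    simp only [slope_def_module, smul_eq_mul]
    constructor
    · refine this.1.trans (le_of_eq (by ring))
    · refine this.2.trans (le_of_eq (by ring))
  constructor
  · intro a
    obtain ⟨C, hC⟩ := main a
    exact differentiableAt_of_slope_cauchy fun k l h1 h2 h3 h4 => (hC k l h1 h2 h3 h4).1
  · intro a
    obtain ⟨C, hC⟩ := main a
    exact differentiableAt_of_slope_cauchy fun k l h1 h2 h3 h4 => (hC k l h1 h2 h3 h4).2

/-! ### Liouville–Green approximation -/

/-- Deviation of a solution of `X' = Θ' X + w` from the solution of the homogeneous equation. -/
lemma norm_sub_exp_mul_le {X w Θ Θ' : ℝ → ℂ} {S : ℝ → ℝ} {c η : ℝ}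
    (hX : ∀ r ∈ Icc (0 : ℝ) 1, HasDerivWithinAt X (Θ' r * X r + w r) (Icc 0 1) r)
    (hΘ : ∀ r ∈ Icc (0 : ℝ) 1, HasDerivWithinAt Θ (Θ' r) (Icc 0 1) r)
    (hre : ∀ r ∈ Icc (0 : ℝ) 1, ∀ s ∈ Icc (0 : ℝ) r, (Θ r - Θ s).re ≤ c + (S r - S s))
    (hw : ∀ s ∈ Icc (0 : ℝ) 1, ‖w s‖ ≤ η * Real.exp (S s)) {r : ℝ} (hr : r ∈ Icc (0 : ℝ) 1) :
    ‖X r - Complex.exp (Θ r - Θ 0) * X 0‖ ≤ Real.exp c * η * Real.exp (S r) := by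
  have hη : 0 ≤ η := nonneg_of_mul_nonneg_left ((norm_nonneg _).trans (hw r hr)) (Real.exp_pos _)
  have hsub : Icc 0 r ⊆ Icc (0 : ℝ) 1 := Icc_subset_Icc_right hr.2
  -- Integrating factor: the s-derivative of exp(Θ r - Θ s) X s is exp(Θ r - Θ s) w s. In its bound
  -- S s cancels, leaving a constant independent of s.
  have h := norm_image_sub_le_of_norm_deriv_le_segment' (f := fun s => Complex.exp (Θ r - Θ s) * X s)
    (f' := fun s => Complex.exp (Θ r - Θ s) * w s) (C := Real.exp c * η * Real.exp (S r))
    (a := 0) (b := r) (fun s hs => by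
      have hd := (((((hΘ s (hsub hs)).const_sub (Θ r)).cexp).mul (hX s (hsub hs)))).mono hsub
      refine hd.congr_deriv ?_
      ring) (fun s hs => by
      have hs' := Ico_subset_Icc_self hs
      rw [norm_mul, Complex.norm_exp]
      calc Real.exp (Θ r - Θ s).re * ‖w s‖
          ≤ Real.exp (c + (S r - S s)) * (η * Real.exp (S s)) :=
            mul_le_mul (Real.exp_le_exp.2 (hre r hr s hs')) (hw s (hsub hs')) (norm_nonneg _)
              (Real.exp_pos _).le
        _ = Real.exp c * η * Real.exp (S r) := by
            rw [show S r = (S r - S s) + S s by ring, Real.exp_add c,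
              Real.exp_add (S r - S s) (S s)]
            ring_nf) r ⟨hr.1, le_rfl⟩
  simp only [sub_self, Complex.exp_zero, one_mul, sub_zero] at h
  refine h.trans (mul_le_of_le_one_right (by positivity) hr.2)

/-- A weakly coupled diagonal system of two equations, started at `(a₀, a₀)`, stays close to the
solution of the uncoupled system. -/
lemma norm_sub_exp_mul_le_of_coupled {X Y v w Θ Θ' : ℝ → ℂ} {S : ℝ → ℝ} {c κ : ℝ} {a₀ : ℂ}
    (hX : ∀ r ∈ Icc (0 : ℝ) 1, HasDerivWithinAt X (Θ' r * X r + v r) (Icc 0 1) r)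
    (hY : ∀ r ∈ Icc (0 : ℝ) 1, HasDerivWithinAt Y (-Θ' r * Y r + w r) (Icc 0 1) r)
    (hX0 : X 0 = a₀) (hY0 : Y 0 = a₀)
    (hΘ : ∀ r ∈ Icc (0 : ℝ) 1, HasDerivWithinAt Θ (Θ' r) (Icc 0 1) r) (hΘ0 : Θ 0 = 0)
    (hS : ContinuousOn S (Icc 0 1)) (hS0 : S 0 = 0)
    (hre : ∀ r ∈ Icc (0 : ℝ) 1, ∀ s ∈ Icc (0 : ℝ) r, |(Θ r - Θ s).re| ≤ c + (S r - S s))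
    (hv : ∀ r ∈ Icc (0 : ℝ) 1, ‖v r‖ ≤ κ * max ‖X r‖ ‖Y r‖)
    (hw : ∀ r ∈ Icc (0 : ℝ) 1, ‖w r‖ ≤ κ * max ‖X r‖ ‖Y r‖)
    (hκ0 : 0 ≤ κ) (hκ : 2 * (Real.exp c * κ) ≤ 1) {r : ℝ} (hr : r ∈ Icc (0 : ℝ) 1) :
    ‖X r - Complex.exp (Θ r) * a₀‖
        ≤ 2 * Real.exp c * Real.exp c * ‖a₀‖ * κ * Real.exp (S r) ∧
      ‖Y r - Complex.exp (-Θ r) * a₀‖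
        ≤ 2 * Real.exp c * Real.exp c * ‖a₀‖ * κ * Real.exp (S r) ∧
      max ‖X r‖ ‖Y r‖ ≤ 2 * Real.exp c * ‖a₀‖ * Real.exp (S r) := by
  have hcX : ContinuousOn X (Icc 0 1) := fun s hs => (hX s hs).continuousWithinAt
  have hcY : ContinuousOn Y (Icc 0 1) := fun s hs => (hY s hs).continuousWithinAt
  -- Bootstrap on the maximum m of the solution weighted by e^{-S}: each deviation is at most e^c κ
  -- m e^S, and 2e^c κ ≤ 1 makes this at most (m/2) e^S. At the maximum point m ≤ e^c‖a₀‖ + m/2, so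
  -- m is bounded.
  obtain ⟨r₀, hr₀, hmax⟩ := isCompact_Icc.exists_isMaxOn (nonempty_Icc.2 zero_le_one)
    (f := fun s => Real.exp (-S s) * max ‖X s‖ ‖Y s‖) (hS.neg.rexp.mul (hcX.norm.sup hcY.norm))
  set m : ℝ := Real.exp (-S r₀) * max ‖X r₀‖ ‖Y r₀‖ with hm
  have hmaxle : ∀ s ∈ Icc (0 : ℝ) 1, max ‖X s‖ ‖Y s‖ ≤ m * Real.exp (S s) := by
    intro s hs
    have h1 : Real.exp (-S s) * max ‖X s‖ ‖Y s‖ ≤ m := hmax hs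
    rw [Real.exp_neg, inv_mul_le_iff₀ (Real.exp_pos _)] at h1
    linarith
  have hbd : ∀ s ∈ Icc (0 : ℝ) 1, κ * max ‖X s‖ ‖Y s‖ ≤ κ * m * Real.exp (S s) := by
    intro s hs
    rw [mul_assoc]
    exact mul_le_mul_of_nonneg_left (hmaxle s hs) hκ0
  have eX : ∀ s ∈ Icc (0 : ℝ) 1, ‖X s - Complex.exp (Θ s) * a₀‖
      ≤ Real.exp c * (κ * m) * Real.exp (S s) := by
    intro s hs
    have := norm_sub_exp_mul_le hX hΘ (fun r hr s hs => (le_abs_self _).trans (hre r hr s hs))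
      (fun s hs => (hv s hs).trans (hbd s hs)) hs
    rwa [hΘ0, sub_zero, hX0] at this
  have eY : ∀ s ∈ Icc (0 : ℝ) 1, ‖Y s - Complex.exp (-Θ s) * a₀‖
      ≤ Real.exp c * (κ * m) * Real.exp (S s) := by
    intro s hs
    have := norm_sub_exp_mul_le (Θ := fun s => -Θ s) (Θ' := fun s => -Θ' s) hY
      (fun r hr => (hΘ r hr).neg) (fun r hr s hs => by
        have h1 := (neg_le_abs _).trans (hre r hr s hs)
        rwa [← Complex.neg_re, neg_sub, ← neg_sub_neg] at h1)
      (fun s hs => (hw s hs).trans (hbd s hs)) hs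
    rwa [hΘ0, neg_zero, sub_zero, hY0] at this
  have hhom : ∀ s ∈ Icc (0 : ℝ) 1, |(Θ s).re| ≤ c + S s := by
    intro s hs
    have := hre s hs 0 ⟨le_rfl, hs.1⟩
    rwa [hΘ0, hS0, sub_zero, sub_zero] at this
  have hm2 : m ≤ 2 * Real.exp c * ‖a₀‖ := by
    have hmm : 0 ≤ m := by positivity
    have key : max ‖X r₀‖ ‖Y r₀‖ ≤ (Real.exp c * ‖a₀‖ + m / 2) * Real.exp (S r₀) := by
      have h1 : Real.exp c * (κ * m) * Real.exp (S r₀) ≤ m / 2 * Real.exp (S r₀) := by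
        refine mul_le_mul_of_nonneg_right ?_ (Real.exp_pos _).le
        nlinarith
      have h2 : ∀ z : ℂ, z.re ≤ |(Θ r₀).re| → ‖Complex.exp z * a₀‖
          ≤ Real.exp c * ‖a₀‖ * Real.exp (S r₀) := by
        intro z hz
        rw [norm_mul, Complex.norm_exp]
        have h3 : Real.exp z.re ≤ Real.exp c * Real.exp (S r₀) := by
          rw [← Real.exp_add]; exact Real.exp_le_exp.2 (hz.trans (hhom r₀ hr₀))
        nlinarith [norm_nonneg a₀]
      have hx := norm_le_norm_add_norm_sub' (X r₀) (Complex.exp (Θ r₀) * a₀)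
      have hy := norm_le_norm_add_norm_sub' (Y r₀) (Complex.exp (-Θ r₀) * a₀)
      have a1 := eX r₀ hr₀
      have a2 := eY r₀ hr₀
      have b1 := h2 (Θ r₀) (le_abs_self _)
      have b2 := h2 (-Θ r₀) (neg_le_abs _)
      refine max_le ?_ ?_ <;> linarith
    have h4 : m ≤ Real.exp c * ‖a₀‖ + m / 2 := by
      rw [hm, Real.exp_neg, inv_mul_le_iff₀ (Real.exp_pos _), ← Real.exp_neg, ← hm]
      linarith
    linarith
  have fin : Real.exp c * (κ * m) * Real.exp (S r)
      ≤ 2 * Real.exp c * Real.exp c * ‖a₀‖ * κ * Real.exp (S r) := by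
    refine mul_le_mul_of_nonneg_right ?_ (Real.exp_pos _).le
    have := mul_le_mul_of_nonneg_left hm2 (mul_nonneg (Real.exp_pos c).le hκ0)
    linarith
  exact ⟨(eX r hr).trans fin, (eY r hr).trans fin,
    (hmaxle r hr).trans (mul_le_mul_of_nonneg_right hm2 (Real.exp_pos _).le)⟩

/-- Liouville-Green asymptotics at the right end point, in terms of `q = √ε`, `p = γ / (2 √ε)`,
the amplitude `a = ε ^ (-1/4)` and its logarithmic derivative `l`. -/
theorem exists_liouville_green_bound {ε γ q p p' l l' a QQ PP : ℝ → ℝ}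
    (hq : ∀ r ∈ Icc (0 : ℝ) 1, HasDerivWithinAt q (-(2 * l r * q r)) (Icc 0 1) r)
    (hp : ∀ r ∈ Icc (0 : ℝ) 1, HasDerivWithinAt p (p' r) (Icc 0 1) r)
    (hl : ∀ r ∈ Icc (0 : ℝ) 1, HasDerivWithinAt l (l' r) (Icc 0 1) r)
    (ha : ∀ r ∈ Icc (0 : ℝ) 1, HasDerivWithinAt a (l r * a r) (Icc 0 1) r)
    (hQQ : ∀ r ∈ Icc (0 : ℝ) 1, HasDerivWithinAt QQ (q r) (Icc 0 1) r)
    (hPP : ∀ r ∈ Icc (0 : ℝ) 1, HasDerivWithinAt PP (p r) (Icc 0 1) r)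
    (hQQ0 : QQ 0 = 0) (hPP0 : PP 0 = 0) (hqpos : ∀ r ∈ Icc (0 : ℝ) 1, 0 < q r)
    (hp'c : ContinuousOn p' (Icc 0 1)) (hl'c : ContinuousOn l' (Icc 0 1))
    (hεq : ∀ r ∈ Icc (0 : ℝ) 1, ε r = q r ^ 2)
    (hγq : ∀ r ∈ Icc (0 : ℝ) 1, γ r = 2 * p r * q r) :
    ∃ K C : ℝ, 0 < K ∧ ∀ k : ℂ, K ≤ ‖k‖ → ∀ u u' : ℝ → ℂ, IsSolution ε γ k u u' →
      ‖2 * Complex.I * k * q 1 * a 1 * u 1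
        - a 0 * (Complex.exp (Complex.I * (k * QQ 1 + Complex.I * PP 1))
          - Complex.exp (-(Complex.I * (k * QQ 1 + Complex.I * PP 1))))‖
        ≤ C / ‖k‖ * Real.exp (|k.im| * QQ 1) ∧
      ‖2 * a 1 * u' 1
        - a 0 * (Complex.exp (Complex.I * (k * QQ 1 + Complex.I * PP 1))
          + Complex.exp (-(Complex.I * (k * QQ 1 + Complex.I * PP 1))))‖
        ≤ C / ‖k‖ * Real.exp (|k.im| * QQ 1) := by
  have hqc : ContinuousOn q (Icc 0 1) := fun s hs => (hq s hs).continuousWithinAt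
  have hpc : ContinuousOn p (Icc 0 1) := fun s hs => (hp s hs).continuousWithinAt
  have hlc : ContinuousOn l (Icc 0 1) := fun s hs => (hl s hs).continuousWithinAt
  have hQc : ContinuousOn QQ (Icc 0 1) := fun s hs => (hQQ s hs).continuousWithinAt
  have hPc : ContinuousOn PP (Icc 0 1) := fun s hs => (hPP s hs).continuousWithinAt
  have h01 : (0 : ℝ) ∈ Icc (0 : ℝ) 1 := ⟨le_rfl, zero_le_one⟩
  have h11 : (1 : ℝ) ∈ Icc (0 : ℝ) 1 := ⟨zero_le_one, le_rfl⟩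
  obtain ⟨r₁, hr₁, hmin⟩ := isCompact_Icc.exists_isMinOn ⟨0, h01⟩ hqc
  set m : ℝ := q r₁ with hm
  have hm0 : 0 < m := hqpos r₁ hr₁
  have hmq : ∀ r ∈ Icc (0 : ℝ) 1, m ≤ q r := fun r hr => hmin hr
  obtain ⟨b, hb⟩ := isCompact_Icc.exists_bound_of_continuousOn hpc
  obtain ⟨L, hL⟩ := isCompact_Icc.exists_bound_of_continuousOn hlc
  obtain ⟨c, hc⟩ := isCompact_Icc.exists_bound_of_continuousOn hPc
  have hb0 : 0 ≤ b := (norm_nonneg _).trans (hb 0 h01)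
  have hL0 : 0 ≤ L := (norm_nonneg _).trans (hL 0 h01)
  -- No k occurs here: in i(ω' + 2lω) the k-terms cancel because q' = -2lq, leaving -(p' + 2pl). The
  -- sign of that term flips between X and Y.
  set g₁ : ℝ → ℝ := fun r => -(p r ^ 2) - (p' r + 2 * p r * l r) - l' r - l r ^ 2 with hg₁
  set g₂ : ℝ → ℝ := fun r => -(p r ^ 2) + (p' r + 2 * p r * l r) - l' r - l r ^ 2 with hg₂
  obtain ⟨G₁, hG₁⟩ := isCompact_Icc.exists_bound_of_continuousOn (f := g₁) (s := Icc (0 : ℝ) 1)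
    (by fun_prop)
  obtain ⟨G₂, hG₂⟩ := isCompact_Icc.exists_bound_of_continuousOn (f := g₂) (s := Icc (0 : ℝ) 1)
    (by fun_prop)
  set G : ℝ := max G₁ G₂ with hG
  have hG0 : 0 ≤ G := (norm_nonneg _).trans ((hG₁ 0 h01).trans (le_max_left _ _))
  have hmono : MonotoneOn QQ (Icc 0 1) := by
    refine monotoneOn_of_hasDerivWithinAt_nonneg (f' := q) (convex_Icc 0 1) hQc
      (fun x hx => (hQQ x (interior_subset hx)).mono interior_subset)
      fun x hx => (hqpos x (interior_subset hx)).le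
  set ec : ℝ := Real.exp (2 * c) with hec
  have hec0 : 0 < ec := Real.exp_pos _
  -- In the lower bound for ‖k‖, the first term gives |ω| ≥ m‖k‖/2 and the second makes the coupling
  -- small enough for the bootstrap. The exponent 2c in `ec` bounds the variation of `PP`.
  refine ⟨2 * b / m + 4 * ec * G / m + 1,
    (8 * ec * ec * ‖(a 0 : ℂ)‖ * G + 8 * (b + L) * ec * ‖(a 0 : ℂ)‖) / m,
    by positivity, fun k hk u u' hu => ?_⟩
  have hk0 : 0 < ‖k‖ := lt_of_lt_of_le (by positivity) hk
  have hkm : 2 * b + 4 * ec * G ≤ m * ‖k‖ := by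
    have h1 : 2 * b / m + 4 * ec * G / m ≤ ‖k‖ := by linarith
    rw [← add_div, div_le_iff₀ hm0] at h1
    linarith
  set ω : ℝ → ℂ := fun r => k * q r + Complex.I * p r with hω
  have hωlow : ∀ r ∈ Icc (0 : ℝ) 1, m * ‖k‖ / 2 ≤ ‖ω r‖ := by
    intro r hr
    have h1 := norm_sub_le_norm_add (k * q r : ℂ) (Complex.I * p r)
    rw [norm_mul, norm_mul, Complex.norm_I, one_mul, Complex.norm_real, Complex.norm_real,
      Real.norm_of_nonneg (hqpos r hr).le] at h1
    have h2 := hb r hr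
    have h3 := mul_le_mul_of_nonneg_left (hmq r hr) hk0.le
    have : 0 ≤ ec * G := by positivity
    simp only [hω]
    linarith
  set X : ℝ → ℂ := fun r => a r * (u' r + (Complex.I * ω r - l r) * u r) with hX
  set Y : ℝ → ℂ := fun r => a r * (u' r - (Complex.I * ω r + l r) * u r) with hY
  have hXY : ∀ r, X r - Y r = 2 * Complex.I * ω r * (a r * u r) := fun r => by
    simp only [hX, hY]; ring
  have hau : ∀ r ∈ Icc (0 : ℝ) 1, ∀ z : ℂ, ∀ B : ℝ, ‖z‖ ≤ B →
      ‖a r * u r * z‖ ≤ B / (m * ‖k‖) * ‖X r - Y r‖ := by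
    intro r hr z B hz
    have h1 : ‖X r - Y r‖ = 2 * ‖ω r‖ * ‖(a r : ℂ) * u r‖ := by
      rw [hXY, norm_mul, norm_mul, norm_mul]; simp
    rw [h1, norm_mul, div_mul_eq_mul_div, le_div_iff₀ (by positivity)]
    have h2 := mul_le_mul hz (show m * ‖k‖ ≤ 2 * ‖ω r‖ by linarith [hωlow r hr]) (by positivity)
      ((norm_nonneg _).trans hz)
    nlinarith [norm_nonneg ((a r : ℂ) * u r)]
  -- The factor 2 comes from ‖X - Y‖ ≤ 2 max(‖X‖, ‖Y‖).
  set κ : ℝ := 2 * G / (m * ‖k‖) with hκ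
  have hforce : ∀ r ∈ Icc (0 : ℝ) 1, ∀ z : ℂ, ‖z‖ ≤ G →
      ‖a r * u r * z‖ ≤ κ * max ‖X r‖ ‖Y r‖ := by
    intro r hr z hz
    refine (hau r hr z G hz).trans ?_
    have h1 : ‖X r - Y r‖ ≤ 2 * max ‖X r‖ ‖Y r‖ := by
      have := norm_sub_le (X r) (Y r)
      linarith [le_max_left ‖X r‖ ‖Y r‖, le_max_right ‖X r‖ ‖Y r‖]
    calc G / (m * ‖k‖) * ‖X r - Y r‖ ≤ G / (m * ‖k‖) * (2 * max ‖X r‖ ‖Y r‖) := by gcongr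
      _ = κ * max ‖X r‖ ‖Y r‖ := by rw [hκ]; ring
  have hωd : ∀ r ∈ Icc (0 : ℝ) 1, HasDerivWithinAt ω
      (k * ((-(2 * l r * q r) : ℝ) : ℂ) + Complex.I * (p' r : ℂ)) (Icc 0 1) r := fun r hr =>
    ((hq r hr).ofReal_comp.const_mul k).add ((hp r hr).ofReal_comp.const_mul Complex.I)
  set Θ : ℝ → ℂ := fun r => Complex.I * (k * QQ r + Complex.I * PP r) with hΘdef
  have hΘ : ∀ r ∈ Icc (0 : ℝ) 1, HasDerivWithinAt Θ (Complex.I * ω r) (Icc 0 1) r := fun r hr =>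
    (((hQQ r hr).ofReal_comp.const_mul k).add
      ((hPP r hr).ofReal_comp.const_mul Complex.I)).const_mul Complex.I
  have I2 : Complex.I ^ 2 = -1 := Complex.I_sq
  have hsys := norm_sub_exp_mul_le_of_coupled (X := X) (Y := Y)
    (v := fun r => a r * u r * (g₁ r : ℂ)) (w := fun r => a r * u r * (g₂ r : ℂ)) (Θ := Θ)
    (Θ' := fun r => Complex.I * ω r) (S := fun r => |k.im| * QQ r) (c := 2 * c) (κ := κ)
    (a₀ := a 0)
    (fun r hr => by
      have hd := (ha r hr).ofReal_comp.mul ((hu.hasDeriv' r hr).add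
        ((((hωd r hr).const_mul Complex.I).sub (hl r hr).ofReal_comp).mul (hu.hasDeriv r hr)))
      refine hd.congr_deriv ?_
      simp only [hX, hω, hg₁, hεq r hr, hγq r hr, Pi.add_apply, Pi.mul_apply, Pi.sub_apply]
      push_cast
      linear_combination (-(k ^ 2 * q r ^ 2 * a r * u r) - a r * u r * p r ^ 2 +
        2 * k * q r * p r * Complex.I * a r * u r + 2 * l r * a r * p r * u r +
        a r * u r * p' r - 4 * a r * k * q r * p r * u r * Complex.I -
        a r * p r ^ 2 * u r * (Complex.I ^ 2 - 2)) * I2)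
    (fun r hr => by
      have hd := (ha r hr).ofReal_comp.mul ((hu.hasDeriv' r hr).sub
        ((((hωd r hr).const_mul Complex.I).add (hl r hr).ofReal_comp).mul (hu.hasDeriv r hr)))
      refine hd.congr_deriv ?_
      simp only [hY, hω, hg₂, hεq r hr, hγq r hr, Pi.add_apply, Pi.mul_apply, Pi.sub_apply]
      push_cast
      linear_combination (-(k ^ 2 * q r ^ 2 * a r * u r) - a r * u r * p r ^ 2 +
        2 * k * q r * p r * Complex.I * a r * u r - 2 * l r * a r * p r * u r -
        a r * u r * p' r - 4 * a r * k * q r * p r * u r * Complex.I -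
        a r * p r ^ 2 * u r * (Complex.I ^ 2 - 2)) * I2)
    (by simp [hX, hu.init, hu.init']) (by simp [hY, hu.init, hu.init']) hΘ
    (by simp [hΘdef, hQQ0, hPP0]) (continuousOn_const.mul hQc) (by simp [hQQ0])
    (fun r hr s hs => by
      have hs1 : s ∈ Icc (0 : ℝ) 1 := ⟨hs.1, hs.2.trans hr.2⟩
      have h1 : (Θ r - Θ s).re = -(k.im * (QQ r - QQ s)) - PP r + PP s := by
        simp [hΘdef]; ring
      have h2 := hmono hs1 hr hs.2
      have h3 := hc r hr
      have h4 := hc s hs1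
      rw [Real.norm_eq_abs] at h3 h4
      have h5 : |-(k.im * (QQ r - QQ s))| = |k.im| * (QQ r - QQ s) := by
        rw [abs_neg, abs_mul, abs_of_nonneg (sub_nonneg.2 h2)]
      rw [h1]
      have h6 := abs_add_le (-(k.im * (QQ r - QQ s)) - PP r) (PP s)
      have h7 := abs_sub (-(k.im * (QQ r - QQ s))) (PP r)
      rw [h5] at h7
      linarith)
    (fun r hr => hforce r hr _ (by
      rw [Complex.norm_real]; exact (hG₁ r hr).trans (le_max_left _ _)))
    (fun r hr => hforce r hr _ (by
      rw [Complex.norm_real]; exact (hG₂ r hr).trans (le_max_right _ _)))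
    (by positivity) (by
      rw [hκ, ← hec, mul_div_assoc', mul_div_assoc', div_le_one (by positivity)]
      linarith) h11
  obtain ⟨eX, eY, eM⟩ := hsys
  rw [← hec] at eX eY eM
  set D : ℝ := 2 * ec * ec * ‖(a 0 : ℂ)‖ * κ * Real.exp (|k.im| * QQ 1) with hD
  set T : ℝ := 4 * ec * ‖(a 0 : ℂ)‖ * Real.exp (|k.im| * QQ 1) with hT
  have hdiff : ‖X 1 - Y 1‖ ≤ T := by
    have h1 := norm_sub_le (X 1) (Y 1)
    linarith [le_max_left ‖X 1‖ ‖Y 1‖, le_max_right ‖X 1‖ ‖Y 1‖]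
  have hsmall : ∀ z : ℂ, ∀ B : ℝ, ‖z‖ ≤ B → ‖a 1 * u 1 * z‖ ≤ B / (m * ‖k‖) * T := by
    intro z B hz
    have hB : 0 ≤ B := (norm_nonneg z).trans hz
    exact (hau 1 h11 z B hz).trans (mul_le_mul_of_nonneg_left hdiff (by positivity))
  have hp1 := hsmall (2 * p 1) (2 * b) (by
    rw [norm_mul, Complex.norm_real, Complex.norm_two]; linarith [hb 1 h11])
  have hl1 := hsmall (2 * l 1) (2 * L) (by
    rw [norm_mul, Complex.norm_real, Complex.norm_two]; linarith [hL 1 h11])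
  have hfin : 2 * D + (2 * b / (m * ‖k‖) * T + 2 * L / (m * ‖k‖) * T)
      = (8 * ec * ec * ‖(a 0 : ℂ)‖ * G + 8 * (b + L) * ec * ‖(a 0 : ℂ)‖) / m / ‖k‖
        * Real.exp (|k.im| * QQ 1) := by
    rw [hD, hT, hκ]
    field_simp
    ring
  have hT0 : 0 ≤ T := (norm_nonneg _).trans hdiff
  have hpos₁ : 0 ≤ 2 * b / (m * ‖k‖) * T := by positivity
  have hpos₂ : 0 ≤ 2 * L / (m * ‖k‖) * T := by positivity
  rw [← hfin]
  constructor
  -- X - Y = 2iωau contains kq + ip rather than kq; the surplus 2p·au is another O(1/‖k‖) term. For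
  -- X + Y the surplus is 2l·au.
  · have e : 2 * Complex.I * k * q 1 * a 1 * u 1 - a 0 * (Complex.exp (Θ 1) - Complex.exp (-Θ 1))
        = (X 1 - Complex.exp (Θ 1) * a 0) - (Y 1 - Complex.exp (-Θ 1) * a 0)
          + a 1 * u 1 * (2 * p 1) := by
      simp only [hX, hY, hω]
      linear_combination (-2 * p 1 * a 1 * u 1) * I2
    change ‖2 * Complex.I * k * q 1 * a 1 * u 1
      - a 0 * (Complex.exp (Θ 1) - Complex.exp (-Θ 1))‖ ≤ _
    rw [e]
    have h1 := norm_add_le ((X 1 - Complex.exp (Θ 1) * a 0) - (Y 1 - Complex.exp (-Θ 1) * a 0))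
      (a 1 * u 1 * (2 * p 1))
    have h2 := norm_sub_le (X 1 - Complex.exp (Θ 1) * a 0) (Y 1 - Complex.exp (-Θ 1) * a 0)
    linarith
  · have e : 2 * a 1 * u' 1 - a 0 * (Complex.exp (Θ 1) + Complex.exp (-Θ 1))
        = (X 1 - Complex.exp (Θ 1) * a 0) + (Y 1 - Complex.exp (-Θ 1) * a 0)
          + a 1 * u 1 * (2 * l 1) := by
      simp only [hX, hY, hω]
      ring
    change ‖2 * a 1 * u' 1 - a 0 * (Complex.exp (Θ 1) + Complex.exp (-Θ 1))‖ ≤ _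
    rw [e]
    have h1 := norm_add_le ((X 1 - Complex.exp (Θ 1) * a 0) + (Y 1 - Complex.exp (-Θ 1) * a 0))
      (a 1 * u 1 * (2 * l 1))
    have h2 := norm_add_le (X 1 - Complex.exp (Θ 1) * a 0) (Y 1 - Complex.exp (-Θ 1) * a 0)
    linarith

/-! ### Affine rescaling and removal of the zero at the origin -/

/-- The hypothesis of `exists_zeros_near_int_mul_pi` in a rescaled variable, and only near
infinity. -/
theorem exists_zeros_near_arithmetic_progression {f : ℂ → ℂ} (hf : Differentiable ℂ f)
    {B D τ K C : ℝ} (hB : 0 < B) (hK : 0 < K)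
    (h : ∀ k : ℂ, K ≤ ‖k‖ → ‖f k - Complex.sin (k * B + Complex.I * D + τ)‖
      ≤ C / ‖k‖ * Real.exp (|k.im| * B)) :
    ∃ z : ℤ → ℂ, (∀ v, {j | z j = v}.encard = analyticOrderAt f v) ∧
      ∃ C' : ℝ, ∀ j : ℤ, j ≠ 0 →
        ‖z j - ((j * Real.pi - τ) / B - Complex.I * D / B)‖ ≤ C' / |(j : ℝ)| := by
  have hBc : (B : ℂ) ≠ 0 := Complex.ofReal_ne_zero.2 hB.ne'
  set g : ℂ → ℂ := fun w => (w - τ - Complex.I * D) / B with hg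
  have hgd : Differentiable ℂ g := by fun_prop
  have hgw : ∀ w, g w * B + Complex.I * D + τ = w := fun w => by
    simp only [hg]; field_simp; ring
  have hFd : Differentiable ℂ (f ∘ g) := hf.comp hgd
  set t : ℝ := |τ| + |D| with ht
  have ht0 : 0 ≤ t := by positivity
  have hwk : ∀ w, ‖w‖ ≤ B * ‖g w‖ + t := by
    intro w
    have h1 := norm_add₃_le (a := g w * B) (b := Complex.I * D) (c := (τ : ℂ))
    rw [hgw, norm_mul, norm_mul, Complex.norm_I, one_mul, Complex.norm_real, Complex.norm_real,
      Complex.norm_real, Real.norm_of_nonneg hB.le, Real.norm_eq_abs, Real.norm_eq_abs] at h1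
    linarith
  have him : ∀ w, |(g w).im| * B ≤ |D| + |w.im| := by
    intro w
    have h1 : w.im = (g w).im * B + D := by
      conv_lhs => rw [← hgw w]
      simp
    have h2 : |(g w).im| * B = |(g w).im * B| := by rw [abs_mul, abs_of_pos hB]
    rw [h2, show (g w).im * B = w.im - D by linarith]
    have := abs_sub w.im D
    linarith
  -- Where ‖g w‖ ≤ K no asymptotics are available, but w then lies in this ball, and the compactness
  -- bound H is adjusted by a factor (1 + BK + t)/(1 + ‖w‖) ≥ 1.
  obtain ⟨H, hH⟩ := (isCompact_closedBall (0 : ℂ) (B * K + t)).exists_bound_of_continuousOn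
    (f := fun w => (f ∘ g) w - Complex.sin w)
    (hFd.continuous.sub Complex.continuous_sin).continuousOn
  have hH0 : 0 ≤ H := (norm_nonneg _).trans (hH 0 (by simp; positivity))
  have hbound : ∀ w, ‖(f ∘ g) w - Complex.sin w‖
      ≤ (|C| * Real.exp |D| * (B + (1 + t) / K) + H * (1 + B * K + t)) / (1 + ‖w‖)
        * Real.exp |w.im| := by
    intro w
    have hw0 : 0 < 1 + ‖w‖ := by positivity
    rcases le_total K ‖g w‖ with hk | hk
    · have hk0 : 0 < ‖g w‖ := hK.trans_le hk
      have h1 := h (g w) hk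
      rw [hgw] at h1
      have h2 : 1 / ‖g w‖ ≤ (B + (1 + t) / K) / (1 + ‖w‖) := by
        rw [div_le_div_iff₀ hk0 hw0, one_mul, add_mul]
        have h3 : 1 + t ≤ (1 + t) / K * ‖g w‖ := by
          rw [div_mul_eq_mul_div, le_div_iff₀ hK]
          exact mul_le_mul_of_nonneg_left hk (by positivity)
        linarith [hwk w]
      calc ‖(f ∘ g) w - Complex.sin w‖ ≤ C / ‖g w‖ * Real.exp (|(g w).im| * B) := h1
        _ ≤ |C| * (1 / ‖g w‖) * (Real.exp |D| * Real.exp |w.im|) := by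
          rw [← Real.exp_add, mul_one_div]
          gcongr
          · exact le_abs_self C
          · exact him w
        _ ≤ |C| * ((B + (1 + t) / K) / (1 + ‖w‖)) * (Real.exp |D| * Real.exp |w.im|) := by
          gcongr
        _ = (|C| * Real.exp |D| * (B + (1 + t) / K)) / (1 + ‖w‖) * Real.exp |w.im| := by ring
        _ ≤ _ := by
          gcongr
          exact le_add_of_nonneg_right (by positivity)
    · have hw : ‖w‖ ≤ B * K + t := (hwk w).trans (by
        have := mul_le_mul_of_nonneg_left hk hB.le
        linarith)
      have h1 := hH w (by simpa using hw)
      have h2 : H ≤ H * (1 + B * K + t) / (1 + ‖w‖) := by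
        rw [le_div_iff₀ hw0]
        exact mul_le_mul_of_nonneg_left (by linarith) hH0
      calc ‖(f ∘ g) w - Complex.sin w‖ ≤ H * (1 + B * K + t) / (1 + ‖w‖) := h1.trans h2
        _ ≤ H * (1 + B * K + t) / (1 + ‖w‖) * Real.exp |w.im| :=
          le_mul_of_one_le_right (by positivity) (Real.one_le_exp (abs_nonneg _))
        _ ≤ _ := by
          gcongr
          exact le_add_of_nonneg_left (by positivity)
  obtain ⟨z, hz, C', hC'⟩ := exists_zeros_near_int_mul_pi hFd hbound
  refine ⟨fun j => g (z j), fun v => ?_, C' / B, fun j hj => ?_⟩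
  · have hgv : g (v * B + Complex.I * D + τ) = v := by
      simp only [hg]; field_simp; ring
    have hset : {j | g (z j) = v} = {j | z j = v * B + Complex.I * D + τ} := by
      ext j
      simp only [mem_ofPred_eq]
      exact ⟨fun e => by rw [← e, hgw], fun e => by rw [e, hgv]⟩
    -- An affine change of variable with nonzero slope preserves orders of vanishing.
    have hderiv : deriv g (v * B + Complex.I * D + τ) ≠ 0 := by
      simp [hg, hBc]
    rw [hset, hz, analyticOrderAt_comp_of_deriv_ne_zero (hgd.analyticAt _) hderiv, hgv]
  · have e : g (z j) - ((j * Real.pi - τ) / B - Complex.I * D / B) = (z j - j * Real.pi) / B := by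
      simp only [hg]; ring
    rw [e, norm_div, Complex.norm_real, Real.norm_of_nonneg hB.le, div_right_comm]
    exact div_le_div_of_nonneg_right (hC' j hj) hB.le

/-- Removing the zero at the origin from a list of the zeros of `k * f k`. -/
lemma exists_enumeratesZeros_of_id_mul {f : ℂ → ℂ} (hf : Differentiable ℂ f) {w c : ℤ → ℂ}
    (hw : ∀ v, {j | w j = v}.encard = analyticOrderAt (fun k => k * f k) v) {C : ℝ}
    (hC : ∀ j : ℤ, j ≠ 0 → ‖w j - c j‖ ≤ C / |(j : ℝ)|) :
    ∃ z : ℤ → ℂ, EnumeratesZeros f {j : ℤ | j ≠ 0} z ∧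
      ∃ C' : ℝ, ∀ j : ℤ, j ≠ 0 → ‖z j - c j‖ ≤ C' / |(j : ℝ)| := by
  have hord : ∀ v, analyticOrderAt (fun k => k * f k) v
      = analyticOrderAt (fun k : ℂ => k) v + analyticOrderAt f v := fun v =>
    analyticOrderAt_mul (f := fun k : ℂ => k) (differentiable_id.analyticAt v) (hf.analyticAt v)
  have hid0 : analyticOrderAt (fun k : ℂ => k) 0 = 1 := analyticOrderAt_id
  obtain ⟨i, hi⟩ : ∃ i, w i = 0 := by
    have h0 : {j | w j = 0}.encard ≠ 0 := by
      rw [hw, hord, hid0]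
      exact (add_pos_of_pos_of_nonneg one_pos zero_le).ne'
    exact Set.encard_ne_zero.1 h0
  -- Swapping 0 with an index i where w vanishes moves a zero at the origin to index 0, which is
  -- then dropped. Only index i receives a displaced value, and this costs the extra summand in the
  -- constant.
  have hσ : ∀ j : ℤ, j ≠ 0 → Equiv.swap 0 i j ≠ i := by
    intro j hj h
    rw [← Equiv.swap_apply_left 0 i] at h
    exact hj ((Equiv.swap 0 i).injective h)
  refine ⟨fun j => w (Equiv.swap 0 i j), ⟨hf, fun v => ?_⟩, |C| + ‖w 0 - c i‖ * |(i : ℝ)|,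
    fun j hj => ?_⟩
  · have himg : (Equiv.swap 0 i) '' {j : ℤ | j ∈ {j : ℤ | j ≠ 0} ∧ w (Equiv.swap 0 i j) = v}
        = {j | w j = v} \ {i} := by
      ext j
      constructor
      · rintro ⟨j, ⟨h1, h2⟩, rfl⟩
        exact ⟨h2, hσ j h1⟩
      · rintro ⟨h1, h2⟩
        refine ⟨Equiv.swap 0 i j, ⟨?_, by simpa using h1⟩, by simp⟩
        intro h
        exact h2 ((Equiv.swap 0 i).injective (by simpa using h))
    rw [← (Equiv.swap 0 i).injective.encard_image, himg]
    by_cases hv : v = 0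
    · subst hv
      have h1 := Set.encard_sdiff_singleton_add_one (s := {j | w j = 0}) (a := i) hi
      rw [hw, hord, hid0, add_comm] at h1
      exact (ENat.add_right_injective_of_ne_top ENat.one_ne_top) h1
    · have h1 : {j | w j = v} \ {i} = {j | w j = v} := by
        refine sdiff_singleton_eq_self ?_
        intro h
        exact hv (h.symm.trans hi)
      have h2 : analyticOrderAt (fun k : ℂ => k) v = 0 :=
        (differentiable_id.analyticAt v).analyticOrderAt_eq_zero.2 hv
      rw [h1, hw, hord, h2, zero_add]
  · have hjpos : 0 < |(j : ℝ)| := abs_pos.2 (Int.cast_ne_zero.2 hj)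
    rw [le_div_iff₀ hjpos]
    beta_reduce
    by_cases hji : j = i
    · subst hji
      rw [Equiv.swap_apply_right]
      linarith [abs_nonneg C]
    · rw [Equiv.swap_apply_of_ne_of_ne hj hji]
      have h1 := hC j hj
      rw [le_div_iff₀ hjpos] at h1
      have : 0 ≤ ‖w 0 - c i‖ * |(i : ℝ)| := by positivity
      linarith [le_abs_self C]

/-! ### Asymptotics at r = 1 for the given coefficients -/

lemma hasDerivWithinAt_integral_Icc {f : ℝ → ℝ} (hf : ContinuousOn f (Icc 0 1)) {r : ℝ}
    (hr : r ∈ Icc (0 : ℝ) 1) :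
    HasDerivWithinAt (fun x => ∫ t in (0 : ℝ)..x, f t) (f r) (Icc 0 1) r := by
  have : Fact (r ∈ Icc (0 : ℝ) 1) := ⟨hr⟩
  refine intervalIntegral.integral_hasDerivWithinAt_right ?_
    (hf.stronglyMeasurableAtFilter_nhdsWithin measurableSet_Icc r) (hf r hr)
  refine (hf.mono ?_).intervalIntegrable
  rw [uIcc_of_le hr.1]
  exact Icc_subset_Icc_right hr.2

/-- Asymptotics of the solution and its derivative at `r = 1`, for large `k`. -/
theorem exists_solution_asymptotics {ε γ : ℝ → ℝ} (hε : ContDiffOn ℝ 2 ε (Icc 0 1))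
    (hγ : ContDiffOn ℝ 2 γ (Icc 0 1)) (hεpos : ∀ r ∈ Icc (0 : ℝ) 1, 0 < ε r)
    {y y' : ℝ → ℂ → ℂ} (hy : ∀ k : ℂ, IsSolution ε γ k (fun r => y r k) (fun r => y' r k)) :
    ∃ c₁ c₂ : ℂ, ∃ K C : ℝ, c₁ ≠ 0 ∧ c₂ ≠ 0 ∧ 0 < K ∧ ∀ k : ℂ, K ≤ ‖k‖ →
      ‖c₁ * (k * y 1 k) - Complex.sin (k * constB ε + Complex.I * constD ε γ)‖
        ≤ C / ‖k‖ * Real.exp (|k.im| * constB ε) ∧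
      ‖c₂ * y' 1 k - Complex.cos (k * constB ε + Complex.I * constD ε γ)‖
        ≤ C / ‖k‖ * Real.exp (|k.im| * constB ε) := by
  have hud : UniqueDiffOn ℝ (Icc (0 : ℝ) 1) := uniqueDiffOn_Icc zero_lt_one
  set ε₁ := derivWithin ε (Icc 0 1) with hε₁
  set ε₂ := derivWithin ε₁ (Icc 0 1) with hε₂
  set γ₁ := derivWithin γ (Icc 0 1) with hγ₁
  have hC1 : ContDiffOn ℝ 1 ε₁ (Icc 0 1) := hε.derivWithin hud (by norm_num)
  have dε : ∀ r ∈ Icc (0 : ℝ) 1, HasDerivWithinAt ε (ε₁ r) (Icc 0 1) r := fun r hr =>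
    (hε.differentiableOn (by norm_num) r hr).hasDerivWithinAt
  have dε₁ : ∀ r ∈ Icc (0 : ℝ) 1, HasDerivWithinAt ε₁ (ε₂ r) (Icc 0 1) r := fun r hr =>
    (hC1.differentiableOn (by norm_num) r hr).hasDerivWithinAt
  have dγ : ∀ r ∈ Icc (0 : ℝ) 1, HasDerivWithinAt γ (γ₁ r) (Icc 0 1) r := fun r hr =>
    (hγ.differentiableOn (by norm_num) r hr).hasDerivWithinAt
  have cε := hε.continuousOn
  have cγ := hγ.continuousOn
  have cε₁ := hC1.continuousOn
  have cε₂ : ContinuousOn ε₂ (Icc 0 1) := hC1.continuousOn_derivWithin hud le_rfl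
  have cγ₁ : ContinuousOn γ₁ (Icc 0 1) := hγ.continuousOn_derivWithin hud (by norm_num)
  have hε0 : ∀ r ∈ Icc (0 : ℝ) 1, ε r ≠ 0 := fun r hr => (hεpos r hr).ne'
  have hs0 : ∀ r ∈ Icc (0 : ℝ) 1, 0 < √(ε r) := fun r hr => Real.sqrt_pos.2 (hεpos r hr)
  have hs0' : ∀ r ∈ Icc (0 : ℝ) 1, √(ε r) ≠ 0 := fun r hr => (hs0 r hr).ne'
  have hsq : ∀ r ∈ Icc (0 : ℝ) 1, √(ε r) ^ 2 = ε r := fun r hr => Real.sq_sqrt (hεpos r hr).le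
  have ds : ∀ r ∈ Icc (0 : ℝ) 1,
      HasDerivWithinAt (fun r => √(ε r)) (ε₁ r / (2 * √(ε r))) (Icc 0 1) r := fun r hr =>
    (dε r hr).sqrt (hε0 r hr)
  have cs : ContinuousOn (fun r => √(ε r)) (Icc 0 1) := cε.sqrt
  have cp : ContinuousOn (fun r => 1 / 2 * (γ r / √(ε r))) (Icc 0 1) :=
    continuousOn_const.mul (cγ.div cs hs0')
  obtain ⟨K, C, hK, hKC⟩ := exists_liouville_green_bound (ε := ε) (γ := γ)
    (q := fun r => √(ε r)) (p := fun r => 1 / 2 * (γ r / √(ε r)))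
    (p' := fun r => 1 / 2 * ((γ₁ r * √(ε r) - γ r * (ε₁ r / (2 * √(ε r)))) / √(ε r) ^ 2))
    (l := fun r => -(1 / 4) * (ε₁ r / ε r))
    (l' := fun r => -(1 / 4) * ((ε₂ r * ε r - ε₁ r * ε₁ r) / ε r ^ 2))
    -- This is ε^(-1/4), written so that its logarithmic derivative is visibly l.
    (a := fun r => Real.exp (-(1 / 4) * Real.log (ε r)))
    (QQ := fun x => ∫ t in (0 : ℝ)..x, √(ε t))
    (PP := fun x => ∫ t in (0 : ℝ)..x, 1 / 2 * (γ t / √(ε t)))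
    (fun r hr => (ds r hr).congr_deriv (by
      have h1 := hs0' r hr
      have h2 := hε0 r hr
      have h3 := hsq r hr
      field_simp
      linear_combination (-4 * ε₁ r) * h3))
    (fun r hr => ((dγ r hr).div (ds r hr) (hs0' r hr)).const_mul _)
    (fun r hr => ((dε₁ r hr).div (dε r hr) (hε0 r hr)).const_mul _)
    (fun r hr => ((((dε r hr).log (hε0 r hr)).const_mul _).exp).congr_deriv (mul_comm _ _))
    (fun r hr => hasDerivWithinAt_integral_Icc cs hr)
    (fun r hr => hasDerivWithinAt_integral_Icc cp hr)
    (by simp) (by simp) hs0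
    (continuousOn_const.mul (((cγ₁.mul cs).sub (cγ.mul (cε₁.div (continuousOn_const.mul cs)
      fun r hr => mul_ne_zero two_ne_zero (hs0' r hr)))).div (cs.pow 2)
      fun r hr => pow_ne_zero 2 (hs0' r hr)))
    (continuousOn_const.mul (((cε₂.mul cε).sub (cε₁.mul cε₁)).div (cε.pow 2)
      fun r hr => pow_ne_zero 2 (hε0 r hr)))
    (fun r hr => (hsq r hr).symm)
    (fun r hr => by have h1 := hs0' r hr; field_simp)
  have eB : ∫ t in (0 : ℝ)..1, √(ε t) = constB ε := rfl
  have eD : ∫ t in (0 : ℝ)..1, 1 / 2 * (γ t / √(ε t)) = constD ε γ := by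
    rw [intervalIntegral.integral_const_mul]; rfl
  simp only [eB, eD] at hKC
  set a₀ : ℝ := Real.exp (-(1 / 4) * Real.log (ε 0)) with ha₀
  set a₁ : ℝ := Real.exp (-(1 / 4) * Real.log (ε 1)) with ha₁
  have ha₀0 : 0 < a₀ := Real.exp_pos _
  have ha₀c : (a₀ : ℂ) ≠ 0 := Complex.ofReal_ne_zero.2 ha₀0.ne'
  have ha₁c : (a₁ : ℂ) ≠ 0 := Complex.ofReal_ne_zero.2 (Real.exp_pos _).ne'
  have hq₁c : ((√(ε 1) : ℝ) : ℂ) ≠ 0 :=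
    Complex.ofReal_ne_zero.2 (hs0' 1 ⟨zero_le_one, le_rfl⟩)
  -- Divides the exponential estimates by 2ia₀ (sine) or 2a₀ (cosine), both of modulus 2a₀.
  have hscale : ∀ w : ℂ, ∀ E M : ℝ, ‖w‖ ≤ C / E * M → ∀ v : ℂ, ‖v‖ = 2 * a₀ → ∀ x, x * v = w →
      ‖x‖ ≤ C / (2 * a₀) / E * M := by
    intro w E M hw v hv x hx
    rw [← hx, norm_mul, hv] at hw
    rw [← mul_le_mul_iff_left₀ (show 0 < 2 * a₀ by positivity)]
    refine hw.trans (le_of_eq ?_)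
    field_simp
  refine ⟨√(ε 1) * a₁ / a₀, a₁ / a₀, K, C / (2 * a₀),
    div_ne_zero (mul_ne_zero hq₁c ha₁c) ha₀c, div_ne_zero ha₁c ha₀c, hK, fun k hk => ?_⟩
  obtain ⟨h1, h2⟩ := hKC k hk _ _ (hy k)
  set θ : ℂ := k * constB ε + Complex.I * constD ε γ with hθ
  have hI : Complex.I * Complex.I = -1 := Complex.I_mul_I
  constructor
  · refine hscale _ _ _ h1 (2 * a₀ * Complex.I) (by simp [abs_of_pos ha₀0]) _ ?_
    rw [Complex.sin, mul_comm Complex.I θ, neg_mul]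
    field_simp
    linear_combination (-a₀ * (Complex.exp (-(θ * Complex.I)) - Complex.exp (θ * Complex.I))) * hI
  · refine hscale _ _ _ h2 (2 * a₀) (by simp [abs_of_pos ha₀0]) _ ?_
    rw [Complex.cos, mul_comm Complex.I θ, neg_mul]
    field_simp

lemma constB_pos {ε : ℝ → ℝ} (hε : ContinuousOn ε (Icc 0 1))
    (hεpos : ∀ r ∈ Icc (0 : ℝ) 1, 0 < ε r) : 0 < constB ε := by
  refine intervalIntegral.intervalIntegral_pos_of_pos_on ?_
    (fun r hr => Real.sqrt_pos.2 (hεpos r (Ioo_subset_Icc_self hr))) zero_lt_one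
  refine ContinuousOn.intervalIntegrable ?_
  rw [uIcc_of_le zero_le_one]
  exact hε.sqrt

lemma analyticOrderAt_const_mul {f : ℂ → ℂ} (hf : Differentiable ℂ f) {c : ℂ} (hc : c ≠ 0) (v : ℂ) :
    analyticOrderAt (fun k => c * f k) v = analyticOrderAt f v := by
  have h := analyticOrderAt_mul (f := fun _ : ℂ => c) (z₀ := v) analyticAt_const (hf.analyticAt v)
  have h0 : analyticOrderAt (fun _ : ℂ => c) v = 0 :=
    (analyticAt_const (x := v)).analyticOrderAt_eq_zero.2 hc
  rw [h0, zero_add] at h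
  exact h

end

/-! ### Conclusion for both boundary values -/

theorem proposition3p3 (ε γ : ℝ → ℝ)
    (hε : ContDiffOn ℝ 2 ε (Set.Icc 0 1)) (hγ : ContDiffOn ℝ 2 γ (Set.Icc 0 1))
    (hεpos : ∀ r ∈ Set.Icc (0 : ℝ) 1, 0 < ε r) (hγnonneg : ∀ r ∈ Set.Icc (0 : ℝ) 1, 0 ≤ γ r)
    (y y' : ℝ → ℂ → ℂ)
    (hy : ∀ k : ℂ, InteriorTransmission.IsSolution ε γ k (fun r => y r k) (fun r => y' r k)) :
    (∃ z : ℤ → ℂ,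
      InteriorTransmission.EnumeratesZeros (fun k => y 1 k) {j : ℤ | j ≠ 0} z ∧
      ∃ C : ℝ, ∀ j : ℤ, j ≠ 0 →
        ‖z j - ((j : ℂ) * (Real.pi : ℂ) / (InteriorTransmission.constB ε : ℂ)
            - Complex.I * (InteriorTransmission.constD ε γ : ℂ)
                / (InteriorTransmission.constB ε : ℂ))‖ ≤ C / |(j : ℝ)|) ∧
    (∃ z' : ℤ → ℂ,
      InteriorTransmission.EnumeratesZeros (fun k => y' 1 k) Set.univ z' ∧
      ∃ C : ℝ, ∀ j : ℤ, j ≠ 0 →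
        ‖z' j - (((j : ℂ) - 1 / 2) * (Real.pi : ℂ) / (InteriorTransmission.constB ε : ℂ)
            - Complex.I * (InteriorTransmission.constD ε γ : ℂ)
                / (InteriorTransmission.constB ε : ℂ))‖ ≤ C / |(j : ℝ)|) := by

  obtain ⟨hd, hd'⟩ := differentiable_solution hε.continuousOn hγ.continuousOn hy
    (r := 1) ⟨zero_le_one, le_rfl⟩
  obtain ⟨c₁, c₂, K, C, hc₁, hc₂, hK, h⟩ := exists_solution_asymptotics hε hγ hεpos hy
  have hB := constB_pos hε.continuousOn hεpos
  have hd₁ : Differentiable ℂ fun k => k * y 1 k := differentiable_id.mul hd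
  constructor
  -- The factor k is what makes this comparable to the sine; its zero at the origin is removed
  -- afterwards.
  · obtain ⟨w, hw, C', hC'⟩ := exists_zeros_near_arithmetic_progression
      (f := fun k => c₁ * (k * y 1 k)) (D := InteriorTransmission.constD ε γ) (τ := 0)
      (hd₁.const_mul c₁) hB hK
      fun k hk => by simpa using (h k hk).1
    refine exists_enumeratesZeros_of_id_mul hd (w := w) (C := C') (fun v => ?_) fun j hj => ?_
    · rw [hw, analyticOrderAt_const_mul hd₁ hc₁]
    · simpa using hC' j hj
  -- Taking τ = π/2 turns the cosine into a sine and yields (jπ - π/2)/B = (j - 1/2)π/B. No zero is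
  -- removed, so index 0 stays.
  · obtain ⟨w, hw, C', hC'⟩ := exists_zeros_near_arithmetic_progression
      (f := fun k => c₂ * y' 1 k) (D := InteriorTransmission.constD ε γ) (τ := Real.pi / 2)
      (hd'.const_mul c₂) hB hK
      fun k hk => by
        have e : ((Real.pi / 2 : ℝ) : ℂ) = Real.pi / 2 := by push_cast; rfl
        rw [e, Complex.sin_add_pi_div_two]
        exact (h k hk).2
    refine ⟨w, ⟨hd', fun v => ?_⟩, C', fun j hj => ?_⟩
    · simpa using (hw v).trans (analyticOrderAt_const_mul hd' hc₂ v)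
    · have := hC' j hj
      rwa [show ((j : ℂ) - 1 / 2) * Real.pi = j * Real.pi - (Real.pi / 2 : ℝ) by push_cast; ring]
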